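/- **Setting.** Fix constants $0<D_L\le D_U<\infty$, a true parameter $\psi_*=(\beta_*,A_*)\in\mathbb R^p\times(0,\infty)$ with $A_*+D_L>(2\pi)^{-1}e^{-3}$, and $\alpha\in(0,1)$. Write $\phi(y;\mu,\sigma^2)$ for the $N(\mu,\sigma^2)$ density. *Model.* Let $(x,D)$ have a law $\nu$ such that almost surely $x\in\mathcal X$ and $D\in[D_L,D_U]$, where $\mathcal X\subset\mathbb R^p$ is bounded, and such that $E[xx^\top]$ is positive definite. For each $m$ let $(x_i,D_i,\theta_i,y_i)$, $i=1,\dots,m$, be i.i.d. with $(x_i,D_i)\sim\nu$, $$\theta_i\mid x_i,D_i\ \sim\ (1-\omega)\,N(x_i^\top\beta_*,A_*)+\omega\,\delta ,\qquad y_i\mid \theta_i,x_i,D_i\ \sim\ N(\theta_i,D_i),$$ where the contamination ratio $\omega=\omega_m\in[0,1/2)$ and the contamination distribution $\delta=\delta_m$ (a probability measure on $\mathbb R$) may depend on $m$. Put $f_\delta(y)=\int\phi(y;\theta,D)\,\delta(d\theta)$ and $$\rho=\max_{k\in\{0,1,2\}}\ \sup_{D\in[D_L,D_U]}\ \sup_{x\in\mathcal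 X}\int f_\delta(y)\,\phi(y;x^\top\beta_*,A_*+D)^{\gamma}\,|y-x^\top\beta_*|^k\,dy .$$ *Interval.* For $\gamma\in(0,1)$ and $\psi=(\beta,A)$ let $$w_\gamma(y_i)=\phi(y_i;x_i^\top\beta,A+D_i)^\gamma\{2\pi(A+D_i)\}^{\gamma^2/(2(1+\gamma))},\qquad \mathcal D_\gamma(y_i;\psi)=\gamma^{-1}w_\gamma(y_i),$$ $$\tilde\theta_i^{(\gamma)}=y_i-w_\gamma(y_i)\tfrac{D_i}{A+D_i}(y_i-x_i^\top\beta),\qquad \tilde s_i^{2(\gamma)}=D_i+w_\gamma(y_i)\tfrac{D_i^2}{(A+D_i)^2}\{\gamma(y_i-x_i^\top\beta)^2-(A+D_i)\}.$$ Let $\Psi\subset\mathbb R^p\times(0,\infty)$ be compact and let $\Psi_m$ be sets with $\psi_*\in\Psi_m\subseteq\Psi$ (for example $\Psi_m=\Psi$). Let $\hat\psi^{(\gamma)}$ be a (measurable) maximizer of $\sum_{i=1}^m\mathcal D_\gamma(y_i;\psi)$ over $\psi\in\Psi_m$, let $\hat\theta_i^{(\gamma)},\hat s_i^{(\gamma)}$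 be $\tilde\theta_i^{(\gamma)}$ and $\sqrt{\tilde s_i^{2(\gamma)}}$ at $\psi=\hat\psi^{(\gamma)}$, and let $$\hat I^{(\gamma)}_{i,1-\alpha}=\bigl(\hat\theta_i^{(\gamma)}-z_{\alpha/2}\hat s_i^{(\gamma)},\ \hat\theta_i^{(\gamma)}+z_{\alpha/2}\hat s_i^{(\gamma)}\bigr),$$ where $z_{\alpha/2}$ is the upper $\alpha/2$-quantile of $N(0,1)$; the interval is empty when $\tilde s_i^{2(\gamma)}\le 0$ at $\hat\psi^{(\gamma)}$. **Theorem.** There is a constant $C>0$, depending only on $p,D_L,D_U,\beta_*,A_*,\alpha$, such that the following holds. Let $0<\underline\gamma<\overline\gamma<1$ and let $\gamma=\gamma_m\in[\underline\gamma,\overline\gamma]$ (for example, a fixed $\gamma$). Assume that $\int y^2f_{\delta_m}(y)\,dy<\infty$ for every $m$ and every $D\in[D_L,D_U]$, and that $\omega_m\rho=O(m^{-\zeta})$ as $m\to\infty$ for some $\zeta\in(0,1/2)$, where $\rho$ is computed with $\delta_m$ and $\gamma_m$. Then for all sufficiently large $m$ and all $i=1,\dots,m$, $$\Bigl|P\bigl(\theta_i\in\hat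 I^{(\gamma)}_{i,1-\alpha}\bigr)-(1-\alpha)\Bigr|\ \le\ C\bigl((\omega_m\rho)^{1/4}+\gamma_m\bigr).$$ -/

import Mathlib

open MeasureTheory ProbabilityTheory Set Filter Topology Asymptotics
open scoped NNReal ENNReal

noncomputable section

namespace RobustFH

/-- Covariate vectors `x` and regression coefficients `β`. -/
abbrev Cov (p : ℕ) := EuclideanSpace ℝ (Fin p)

/-- Parameters `ψ = (β, A)`. -/
abbrev Param (p : ℕ) := Cov p × ℝ

variable {p : ℕ}

/-- The linear predictor `xᵀ β`. -/
def lin (x β : Cov p) : ℝ := ∑ j, x j * β j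

/-- The density at `y` of the normal distribution with mean `μ` and variance `σ2`. -/
def phi (y μ σ2 : ℝ) : ℝ := gaussianPDFReal μ σ2.toNNReal y

/-! ### The model -/

/-- Huber contaminated conditional law of `θ` given `(x, D)`:
`(1 - ω) N(xᵀβ, A) + ω δ`. -/
def thetaKernel (β : Cov p) (A ω : ℝ) (δ : Measure ℝ) : Kernel (Cov p × ℝ) ℝ where
  toFun z := ENNReal.ofReal (1 - ω) • gaussianReal (lin z.1 β) A.toNNReal + ENNReal.ofReal ω • δ
  measurable' := by
    have h1 : Measurable fun z : Cov p × ℝ => gaussianReal (lin z.1 β) A.toNNReal := by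
      have h : Measurable fun z : Cov p × ℝ => (lin z.1 β, A.toNNReal) := by
        unfold lin
        fun_prop
      exact measurable_gaussianReal.comp h
    refine Measure.measurable_of_measurable_coe _ fun s hs => ?_
    have h2 := (Measure.measurable_coe hs).comp h1
    simp only [Measure.coe_add, Measure.coe_smul, Pi.add_apply, Pi.smul_apply, smul_eq_mul]
    exact (h2.const_mul _).add_const _

/-- Conditional law of `y` given `((x, D), θ)`: `N(θ, D)`. -/
def obsKernel (p : ℕ) : Kernel ((Cov p × ℝ) × ℝ) ℝ where
  toFun z := gaussianReal z.2 z.1.2.toNNReal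
  measurable' := by
    have h : Measurable fun z : (Cov p × ℝ) × ℝ => (z.2, z.1.2.toNNReal) := by fun_prop
    exact measurable_gaussianReal.comp h

/-- Joint law of `(((x, D), θ), y)` for one area, when `(x, D)` has law `ν`. -/
def areaLaw (ν : Measure (Cov p × ℝ)) (β : Cov p) (A ω : ℝ) (δ : Measure ℝ) :
    Measure (((Cov p × ℝ) × ℝ) × ℝ) :=
  (ν ⊗ₘ thetaKernel β A ω δ) ⊗ₘ obsKernel p

/-- `f_δ(y) = ∫ φ(y; θ, D) δ(dθ)`, the marginal density of `y` when `θ ∼ δ`. -/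
def margDens (δ : Measure ℝ) (D y : ℝ) : ℝ := ∫ θ, phi y θ D ∂δ

/-- The separability index
`ρ = max_{k ∈ {0,1,2}} sup_{D ∈ [DL, DU]} sup_{x ∈ 𝒳} ∫ f_δ(y) φ(y; xᵀβ, A + D)^γ |y - xᵀβ|^k dy`. -/
def rho (𝒳 : Set (Cov p)) (DL DU : ℝ) (β : Cov p) (A γ : ℝ) (δ : Measure ℝ) : ℝ :=
  ⨆ k : Fin 3, ⨆ D : Icc DL DU, ⨆ x : 𝒳,
    ∫ y, margDens δ D y * phi y (lin x.1 β) (A + D) ^ γ * |y - lin x.1 β| ^ (k : ℕ)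

/-- The second moment matrix `E[x xᵀ]`. -/
def secondMoment (ν : Measure (Cov p × ℝ)) : Matrix (Fin p) (Fin p) ℝ :=
  Matrix.of fun j k => ∫ z, z.1 j * z.1 k ∂ν

/-! ### The γ-divergence empirical Bayes interval -/

/-- `c_γ(A) = {2π(A + D)}^{γ² / (2(1+γ))}`. -/
def cGamma (γ A D : ℝ) : ℝ := (2 * Real.pi * (A + D)) ^ (γ ^ 2 / (2 * (1 + γ)))

/-- `w_γ(y) = φ(y; xᵀβ, A + D)^γ c_γ(A)`. -/
def wGamma (γ : ℝ) (ψ : Param p) (x : Cov p) (D y : ℝ) : ℝ :=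
  phi y (lin x ψ.1) (ψ.2 + D) ^ γ * cGamma γ ψ.2 D

/-- The generalized log-likelihood `𝒟_γ(y; ψ) = γ⁻¹ w_γ(y)` of one area. -/
def gammaLik (γ : ℝ) (ψ : Param p) (x : Cov p) (D y : ℝ) : ℝ := 1 / γ * wGamma γ ψ x D y

/-- `ψ` maximizes `∑ i, 𝒟_γ(y i; ψ)` over the search set `S`. -/
def IsGammaEstimate {m : ℕ} (γ : ℝ) (S : Set (Param p))
    (x : Fin m → Cov p) (D y : Fin m → ℝ) (ψ : Param p) : Prop :=
  ψ ∈ S ∧ ∀ ψ' ∈ S, ∑ i, gammaLik γ ψ' (x i) (D i) (y i) ≤ ∑ i, gammaLik γ ψ (x i) (D i) (y i)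

/-- Robust posterior mean. -/
def thetaTilde (γ : ℝ) (ψ : Param p) (x : Cov p) (D y : ℝ) : ℝ :=
  y - wGamma γ ψ x D y * (D / (ψ.2 + D)) * (y - lin x ψ.1)

/-- Robust posterior variance. -/
def sTildeSq (γ : ℝ) (ψ : Param p) (x : Cov p) (D y : ℝ) : ℝ :=
  D + wGamma γ ψ x D y * (D ^ 2 / (ψ.2 + D) ^ 2) * (γ * (y - lin x ψ.1) ^ 2 - (ψ.2 + D))

/-- Upper quantile `z_a` of the standard normal distribution: `P(Z > z_a) = a`
for `a ∈ (0, 1)`. -/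
def zUpper (a : ℝ) : ℝ := sInf {z : ℝ | gaussianReal 0 1 (Ioi z) ≤ ENNReal.ofReal a}

/-- The interval `(θ̃ - z_{α/2} s̃, θ̃ + z_{α/2} s̃)` at the parameter `ψ`. If `s̃² ≤ 0`, then
`√s̃² = 0` and the interval is empty. -/
def robustInterval (α γ : ℝ) (ψ : Param p) (x : Cov p) (D y : ℝ) : Set ℝ :=
  Ioo (thetaTilde γ ψ x D y - zUpper (α / 2) * √(sTildeSq γ ψ x D y))
    (thetaTilde γ ψ x D y + zUpper (α / 2) * √(sTildeSq γ ψ x D y))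

end RobustFH

end

/-! Since `γ m ≥ γlo > 0` and "sufficiently large" may depend on `γlo`, any error that is eventually
at most `γlo` is absorbed by `C * γ m`. So no rate of convergence is needed: consistency of `ψhat`
and `ω * rho → 0` are enough, and the term `(ω * rho) ^ (1/4)` enters only through its
nonnegativity. What needs care is that `C` be free of `γlo`, `γhi`, `𝒳`, `ν` and `Ψ`.

Coverage at the true parameter (`exists_coverage_bound`). On the clean component, Bayes' formula
makes `θ` given `y` normal, and the Bayes interval covers it with probability exactly `1 - α`. The
weight satisfies `|w - 1| ≤ K γ (1 + u²)` in the residual `u`, so the robust endpoints are off by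
`O(γ (1 + |u|³))`, and the bounded posterior density turns this into a coverage error `O(γ)`. On the
contaminated component the conditioning is reversed. When `|y|` is large the weight vanishes and the
interval is nearly `y ± z √D`, which covers `θ` with probability `1 - α` because `y` given `θ` is
`N(θ, D)`. Only the event `|y| ≤ R` does damage, and its contaminated mass is at most `rho / c`.

Consistency (`exists_estimate_far_le`). The mean weight under the clean model is explicit and is
maximal exactly at the true parameter: strict concavity of `log` identifies the variance, and
positive definiteness of `E[x xᵀ]` identifies `β`. Contamination barely moves the objective because
far observations get almost no weight. Hoeffding's inequality on a finite net, together with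
equicontinuity in `ψ`, rules out maximizers away from the truth.

Sandwich (`exists_interval_sandwich`). Once `ψhat` is near the truth, the estimated interval lies
between two deterministic perturbations of the true-parameter interval, with half-width changed by
`± γlo`. The coverage bound applies to both, so the dependence between `ψhat` and area `i` never has
to be analysed. -/

noncomputable section

namespace RobustFH

variable {p : ℕ}

/-! ### The weight, shift and variance correction in residual coordinates -/

/-- The weight `w_γ` as a function of the total variance `s = A + D` and the residual
`u = y - xᵀβ`. -/
def weight (γ s u : ℝ) : ℝ :=
  (2 * Real.pi * s) ^ (-(γ / (2 * (1 + γ)))) * Real.exp (-(γ * u ^ 2) / (2 * s))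

/-- The shift `y - θ̃` as a function of the residual. -/
def shift (γ s D u : ℝ) : ℝ := weight γ s u * (D / s) * u

/-- The variance correction `s̃² - D` as a function of the residual. -/
def varShift (γ s D u : ℝ) : ℝ := weight γ s u * (D ^ 2 / s ^ 2) * (γ * u ^ 2 - s)

lemma phi_eq {y μ s : ℝ} (hs : 0 < s) :
    phi y μ s = (2 * Real.pi * s) ^ (-(1 / 2) : ℝ) * Real.exp (-(y - μ) ^ 2 / (2 * s)) := by
  have h : 0 < 2 * Real.pi * s := by positivity
  rw [phi, gaussianPDFReal_def, Real.coe_toNNReal _ hs.le, Real.rpow_neg h.le, Real.sqrt_eq_rpow]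

/-- The powers of `2π(A + D)` combine by `-γ/2 + γ²/(2(1+γ)) = -γ/(2(1+γ))`. -/
lemma wGamma_eq {γ : ℝ} (hγ : 0 ≤ γ) {ψ : Param p} {x : Cov p} {D y : ℝ} (hs : 0 < ψ.2 + D) :
    wGamma γ ψ x D y = weight γ (ψ.2 + D) (y - lin x ψ.1) := by
  have h : 0 < 2 * Real.pi * (ψ.2 + D) := by positivity
  rw [wGamma, cGamma, weight, phi_eq hs, Real.mul_rpow (by positivity) (by positivity),
    ← Real.rpow_mul h.le, ← Real.exp_mul, mul_right_comm, ← Real.rpow_add h]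
  congr 2
  · field_simp
    ring
  · field_simp

lemma thetaTilde_eq {γ : ℝ} (hγ : 0 ≤ γ) {ψ : Param p} {x : Cov p} {D y : ℝ} (hs : 0 < ψ.2 + D) :
    thetaTilde γ ψ x D y = y - shift γ (ψ.2 + D) D (y - lin x ψ.1) := by
  rw [thetaTilde, shift, wGamma_eq hγ hs]

lemma sTildeSq_eq {γ : ℝ} (hγ : 0 ≤ γ) {ψ : Param p} {x : Cov p} {D y : ℝ} (hs : 0 < ψ.2 + D) :
    sTildeSq γ ψ x D y = D + varShift γ (ψ.2 + D) D (y - lin x ψ.1) := by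
  rw [sTildeSq, varShift, wGamma_eq hγ hs]

lemma weight_pos {γ s u : ℝ} (hs : 0 < s) : 0 < weight γ s u := by
  unfold weight
  positivity

/-! ### Uniform continuity and tails from a Gaussian envelope -/

section Decay

lemma tendsto_quad_mul_exp_cocompact {k : ℝ} (hk : 0 < k) (C : ℝ) :
    Tendsto (fun u : ℝ => C * (1 + u ^ 2) * Real.exp (-k * u ^ 2)) (cocompact ℝ) (𝓝 0) := by
  have h0 := tendsto_rpow_abs_mul_exp_neg_mul_sq_cocompact hk 0
  have h2 := tendsto_rpow_abs_mul_exp_neg_mul_sq_cocompact hk 2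
  have h := (h0.add h2).const_mul C
  simp only [add_zero, mul_zero] at h
  refine h.congr fun u => ?_
  simp only [Real.rpow_zero, Real.rpow_two, sq_abs]
  ring

variable {X : Type*} {K : Set X} {g : ℝ → X → ℝ} {C k : ℝ}

lemma tail_of_quad_exp_bound (hk : 0 < k)
    (hb : ∀ u, ∀ x ∈ K, |g u x| ≤ C * (1 + u ^ 2) * Real.exp (-k * u ^ 2)) :
    ∀ ε > 0, ∃ R, ∀ u, ∀ x ∈ K, R < |u| → |g u x| ≤ ε := by
  intro ε hε
  have h := (tendsto_quad_mul_exp_cocompact hk C).eventually (eventually_le_nhds hε)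
  rw [← Metric.cobounded_eq_cocompact] at h
  obtain ⟨R, -, hR⟩ := (Metric.hasBasis_cobounded_compl_closedBall (0 : ℝ)).eventually_iff.1 h
  refine ⟨R, fun u x hx hu => (hb u x hx).trans (hR ?_)⟩
  simpa using hu

/-- A continuous function vanishing at infinity is uniformly continuous. Compactness of `K` makes
the projection `ℝ × K → ℝ` proper, so decay in `u` alone is decay at infinity on the product. -/
lemma unifCont_of_quad_exp_bound [MetricSpace X] (hK : IsCompact K) (hk : 0 < k)
    (hg : ContinuousOn (fun z : ℝ × X => g z.1 z.2) (univ ×ˢ K))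
    (hb : ∀ u, ∀ x ∈ K, |g u x| ≤ C * (1 + u ^ 2) * Real.exp (-k * u ^ 2)) :
    ∀ ε > 0, ∃ r > 0, ∀ u u', ∀ x ∈ K, ∀ x' ∈ K, |u - u'| < r → dist x x' < r →
      |g u x - g u' x'| < ε := by
  have : CompactSpace K := isCompact_iff_compactSpace.1 hK
  let f : ℝ × K → ℝ := fun z => g z.1 z.2
  have hf : Continuous f :=
    hg.comp_continuous (f := fun z : ℝ × K => (z.1, (z.2 : X))) (by fun_prop) fun z => by simp
  have hfst : Tendsto (Prod.fst : ℝ × K → ℝ) (cocompact _) (cocompact _) :=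
    (isProperMap_iff_tendsto_cocompact.1 isProperMap_fst_of_compactSpace).2
  have hlim : Tendsto f (cocompact _) (𝓝 0) :=
    squeeze_zero_norm (fun z => hb z.1 z.2 z.2.2)
      ((tendsto_quad_mul_exp_cocompact hk C).comp hfst)
  have hu := hf.uniformContinuous_of_tendsto_cocompact hlim
  intro ε hε
  obtain ⟨r, hr, h⟩ := Metric.uniformContinuous_iff.1 hu ε hε
  refine ⟨r, hr, fun u u' x hx x' hx' hd hdx => ?_⟩
  exact h (a := (u, ⟨x, hx⟩)) (b := (u', ⟨x', hx'⟩)) (max_lt hd hdx)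

end Decay

/-! ### Uniformity over variances and tuning parameters -/

section Box

variable {DL DU s2 γlo γhi : ℝ}

/-- The box of admissible `(s, γ, D)`. -/
def box (DL DU s2 γlo γhi : ℝ) : Set (ℝ × ℝ × ℝ) := Icc DL s2 ×ˢ Icc γlo γhi ×ˢ Icc DL DU

lemma isCompact_box : IsCompact (box DL DU s2 γlo γhi) :=
  isCompact_Icc.prod (isCompact_Icc.prod isCompact_Icc)

lemma mem_box {z : ℝ × ℝ × ℝ} : z ∈ box DL DU s2 γlo γhi ↔
    (DL ≤ z.1 ∧ z.1 ≤ s2) ∧ (γlo ≤ z.2.1 ∧ z.2.1 ≤ γhi) ∧ DL ≤ z.2.2 ∧ z.2.2 ≤ DU := by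
  simp only [box, mem_prod, mem_Icc]

lemma continuousOn_weight (hDL : 0 < DL) (hγ : 0 < γlo) :
    ContinuousOn (fun z : ℝ × ℝ × ℝ × ℝ => weight z.2.2.1 z.2.1 z.1)
      (univ ×ˢ box DL DU s2 γlo γhi) := by
  unfold weight
  have hpos : ∀ z ∈ (univ : Set ℝ) ×ˢ box DL DU s2 γlo γhi, 0 < z.2.1 ∧ 0 < z.2.2.1 :=
    fun z hz => by
      have := mem_box.1 hz.2
      constructor <;> linarith [this.1.1, this.2.1.1]
  refine ContinuousOn.mul (ContinuousOn.rpow (by fun_prop) ?_ fun z hz => Or.inl ?_)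
    (Real.continuous_exp.comp_continuousOn (ContinuousOn.div (by fun_prop) (by fun_prop) ?_))
  · refine ContinuousOn.neg (ContinuousOn.div (by fun_prop) (by fun_prop) fun z hz => ?_)
    have := hpos z hz
    exact mul_ne_zero two_ne_zero (by linarith [this.2])
  · have := (hpos z hz).1
    positivity
  · intro z hz
    have := (hpos z hz).1
    positivity

/-- The Gaussian rate `γ / (2s)` is at least `γlo / (2 s2)` on the box; this is where `γ` must stay
away from `0`. The prefactor is the weight at `u = 0`, bounded by compactness. -/
lemma weight_le_exp (hDL : 0 < DL) (hγ : 0 < γlo) :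
    ∃ W > 0, ∀ u, ∀ z ∈ box DL DU s2 γlo γhi,
      |weight z.2.1 z.1 u| ≤ W * Real.exp (-(γlo / (2 * s2)) * u ^ 2) := by
  have hc : ContinuousOn (fun z : ℝ × ℝ × ℝ => weight z.2.1 z.1 0) (box DL DU s2 γlo γhi) :=
    (continuousOn_weight (DL := DL) (DU := DU) (s2 := s2) hDL hγ).comp
      (t := univ ×ˢ box DL DU s2 γlo γhi) (f := fun z => ((0 : ℝ), z)) (by fun_prop) fun z hz => ⟨mem_univ _, hz⟩
  obtain ⟨W, hW⟩ := isCompact_box.exists_bound_of_continuousOn hc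
  refine ⟨max W 1, by positivity, fun u z hz => ?_⟩
  have hb := mem_box.1 hz
  have hs : 0 < z.1 := by linarith [hb.1.1]
  have h1 := (hW z hz).trans (le_max_left W 1)
  have h2 : weight z.2.1 z.1 u = weight z.2.1 z.1 0 * Real.exp (-(z.2.1 * u ^ 2) / (2 * z.1)) := by
    simp [weight]
  rw [h2, abs_mul, Real.abs_exp]
  have h3 : -(z.2.1 * u ^ 2) / (2 * z.1) ≤ -(γlo / (2 * s2)) * u ^ 2 := by
    have : γlo / (2 * s2) ≤ z.2.1 / (2 * z.1) := by
      gcongr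
      · linarith [hb.2.1.1]
      · exact hb.2.1.1
      · exact hb.1.2
    have := mul_le_mul_of_nonneg_right this (sq_nonneg u)
    calc -(z.2.1 * u ^ 2) / (2 * z.1) = -(z.2.1 / (2 * z.1) * u ^ 2) := by ring
      _ ≤ _ := by linarith
  gcongr
  exact h1

/-- Uniform continuity and uniform decay in the residual of `weight * (a + b u + c u²)`. -/
lemma unif_of_weight_mul (hDL : 0 < DL) (hs2 : 0 < s2) (hγ : 0 < γlo) {a b c : ℝ × ℝ × ℝ → ℝ}
    (ha : ContinuousOn a (box DL DU s2 γlo γhi)) (hb : ContinuousOn b (box DL DU s2 γlo γhi))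
    (hc : ContinuousOn c (box DL DU s2 γlo γhi)) :
    (∀ ε > 0, ∃ r > 0, ∀ u u', ∀ z ∈ box DL DU s2 γlo γhi, ∀ z' ∈ box DL DU s2 γlo γhi,
      |u - u'| < r → dist z z' < r →
      |weight z.2.1 z.1 u * (a z + b z * u + c z * u ^ 2) -
        weight z'.2.1 z'.1 u' * (a z' + b z' * u' + c z' * u' ^ 2)| < ε) ∧
    (∀ ε > 0, ∃ R, ∀ u, ∀ z ∈ box DL DU s2 γlo γhi, R < |u| →
      |weight z.2.1 z.1 u * (a z + b z * u + c z * u ^ 2)| ≤ ε) := by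
  obtain ⟨W, hW0, hW⟩ := weight_le_exp (DU := DU) (s2 := s2) (γhi := γhi) hDL hγ
  obtain ⟨Ca, hCa⟩ := isCompact_box.exists_bound_of_continuousOn ha
  obtain ⟨Cb, hCb⟩ := isCompact_box.exists_bound_of_continuousOn hb
  obtain ⟨Cc, hCc⟩ := isCompact_box.exists_bound_of_continuousOn hc
  have hk : 0 < γlo / (2 * s2) := by positivity
  have hbd : ∀ u, ∀ z ∈ box DL DU s2 γlo γhi,
      |weight z.2.1 z.1 u * (a z + b z * u + c z * u ^ 2)| ≤
        W * (|Ca| + |Cb| + |Cc|) * (1 + u ^ 2) * Real.exp (-(γlo / (2 * s2)) * u ^ 2) := by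
    intro u z hz
    have h1 : |a z + b z * u + c z * u ^ 2| ≤ (|Ca| + |Cb| + |Cc|) * (1 + u ^ 2) := by
      have e1 := (hCa z hz).trans (le_abs_self Ca)
      have e2 := (hCb z hz).trans (le_abs_self Cb)
      have e3 := (hCc z hz).trans (le_abs_self Cc)
      rw [Real.norm_eq_abs] at e1 e2 e3
      have hu : |u| ≤ 1 + u ^ 2 := by
        rw [← sq_abs]
        nlinarith [sq_nonneg (|u| - 1), abs_nonneg u]
      have hu1 : (1 : ℝ) ≤ 1 + u ^ 2 := by nlinarith [sq_nonneg u]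
      have hu2 : u ^ 2 ≤ 1 + u ^ 2 := by linarith
      calc |a z + b z * u + c z * u ^ 2| ≤ |a z| + |b z| * |u| + |c z| * u ^ 2 := by
            refine (abs_add_le _ _).trans (add_le_add ((abs_add_le _ _).trans ?_) ?_)
            · rw [abs_mul]
            · rw [abs_mul, abs_of_nonneg (sq_nonneg u)]
        _ ≤ |Ca| * (1 + u ^ 2) + |Cb| * (1 + u ^ 2) + |Cc| * (1 + u ^ 2) := by
            gcongr
            nlinarith [abs_nonneg (a z), abs_nonneg Ca]
        _ = _ := by ring
    rw [abs_mul]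
    calc _ ≤ (W * Real.exp (-(γlo / (2 * s2)) * u ^ 2)) * ((|Ca| + |Cb| + |Cc|) * (1 + u ^ 2)) := by
          gcongr
          exact hW u z hz
      _ = _ := by ring
  refine ⟨unifCont_of_quad_exp_bound
    (g := fun u z => weight z.2.1 z.1 u * (a z + b z * u + c z * u ^ 2)) isCompact_box hk ?_ hbd,
    tail_of_quad_exp_bound
    (g := fun u z => weight z.2.1 z.1 u * (a z + b z * u + c z * u ^ 2)) hk hbd⟩
  have e : MapsTo Prod.snd ((univ : Set ℝ) ×ˢ box DL DU s2 γlo γhi) (box DL DU s2 γlo γhi) :=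
    fun z hz => hz.2
  have hsnd : ContinuousOn (Prod.snd : ℝ × ℝ × ℝ × ℝ → ℝ × ℝ × ℝ) (univ ×ˢ box DL DU s2 γlo γhi) :=
    continuousOn_snd
  exact (continuousOn_weight hDL hγ).mul (((ha.comp hsnd e).add ((hb.comp hsnd e).mul
    continuousOn_fst)).add ((hc.comp hsnd e).mul (continuousOn_fst.pow 2)))

lemma unif_weight (hDL : 0 < DL) (hs2 : 0 < s2) (hγ : 0 < γlo) :
    (∀ ε > 0, ∃ r > 0, ∀ u u', ∀ s ∈ Icc DL s2, ∀ s' ∈ Icc DL s2, ∀ γ ∈ Icc γlo γhi,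
      |u - u'| < r → |s - s'| < r → |weight γ s u - weight γ s' u'| < ε) ∧
    (∀ ε > 0, ∃ R, ∀ u, ∀ s ∈ Icc DL s2, ∀ γ ∈ Icc γlo γhi, R < |u| → |weight γ s u| ≤ ε) := by
  -- The weight does not involve `D`, so the third coordinate of the box is collapsed to the single
  -- point `DL`.
  have h := unif_of_weight_mul (DL := DL) (DU := DL) (s2 := s2) (γlo := γlo) (γhi := γhi)
    (a := fun _ => 1) (b := fun _ => 0) (c := fun _ => 0) hDL hs2 hγ
    continuousOn_const continuousOn_const continuousOn_const
  simp only [zero_mul, add_zero, mul_one] at h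
  refine ⟨fun ε hε => ?_, fun ε hε => ?_⟩
  · obtain ⟨r, hr, H⟩ := h.1 ε hε
    refine ⟨r, hr, fun u u' s hs s' hs' γ hγ' hu hd =>
      H u u' (s, γ, DL) ⟨hs, hγ', by simp⟩ (s', γ, DL) ⟨hs', hγ', by simp⟩ hu ?_⟩
    simpa [Prod.dist_eq, Real.dist_eq, hr] using hd
  · obtain ⟨R, H⟩ := h.2 ε hε
    exact ⟨R, fun u s hs γ hγ' hu => H u (s, γ, DL) ⟨hs, hγ', by simp⟩ hu⟩

lemma unif_shift (hDL : 0 < DL) (hs2 : 0 < s2) (hγ : 0 < γlo) :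
    (∀ ε > 0, ∃ r > 0, ∀ u u', ∀ s ∈ Icc DL s2, ∀ s' ∈ Icc DL s2, ∀ γ ∈ Icc γlo γhi,
      ∀ D ∈ Icc DL DU, |u - u'| < r → |s - s'| < r →
        |shift γ s D u - shift γ s' D u'| < ε) ∧
    (∀ ε > 0, ∃ R, ∀ u, ∀ s ∈ Icc DL s2, ∀ γ ∈ Icc γlo γhi, ∀ D ∈ Icc DL DU, R < |u| →
      |shift γ s D u| ≤ ε) := by
  have h := unif_of_weight_mul (DL := DL) (DU := DU) (s2 := s2) (γlo := γlo) (γhi := γhi)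
    (a := fun _ => 0) (b := fun z => z.2.2 / z.1) (c := fun _ => 0) hDL hs2 hγ
    continuousOn_const (ContinuousOn.div (by fun_prop) (by fun_prop) fun z hz =>
      (hDL.trans_le (mem_box.1 hz).1.1).ne') continuousOn_const
  simp only [zero_mul, add_zero, zero_add, ← mul_assoc] at h
  refine ⟨fun ε hε => ?_, fun ε hε => ?_⟩
  · obtain ⟨r, hr, H⟩ := h.1 ε hε
    refine ⟨r, hr, fun u u' s hs s' hs' γ hγ' D hD hu hd =>
      H u u' (s, γ, D) ⟨hs, hγ', hD⟩ (s', γ, D) ⟨hs', hγ', hD⟩ hu ?_⟩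
    simpa [Prod.dist_eq, Real.dist_eq, hr] using hd
  · obtain ⟨R, H⟩ := h.2 ε hε
    exact ⟨R, fun u s hs γ hγ' D hD hu => H u (s, γ, D) ⟨hs, hγ', hD⟩ hu⟩

lemma unif_varShift (hDL : 0 < DL) (hs2 : 0 < s2) (hγ : 0 < γlo) :
    (∀ ε > 0, ∃ r > 0, ∀ u u', ∀ s ∈ Icc DL s2, ∀ s' ∈ Icc DL s2, ∀ γ ∈ Icc γlo γhi,
      ∀ D ∈ Icc DL DU, |u - u'| < r → |s - s'| < r →
        |varShift γ s D u - varShift γ s' D u'| < ε) ∧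
    (∀ ε > 0, ∃ R, ∀ u, ∀ s ∈ Icc DL s2, ∀ γ ∈ Icc γlo γhi, ∀ D ∈ Icc DL DU, R < |u| →
      |varShift γ s D u| ≤ ε) := by
  have hne : ∀ z ∈ box DL DU s2 γlo γhi, z.1 ^ 2 ≠ 0 := fun z hz =>
    pow_ne_zero 2 (hDL.trans_le (mem_box.1 hz).1.1).ne'
  have h := unif_of_weight_mul (DL := DL) (DU := DU) (s2 := s2) (γlo := γlo) (γhi := γhi)
    (a := fun z => -(z.2.2 ^ 2 / z.1 ^ 2 * z.1)) (b := fun _ => 0)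
    (c := fun z => z.2.2 ^ 2 / z.1 ^ 2 * z.2.1) hDL hs2 hγ
    (((ContinuousOn.div (by fun_prop) (by fun_prop) hne).mul (by fun_prop)).neg) continuousOn_const
    ((ContinuousOn.div (by fun_prop) (by fun_prop) hne).mul (by fun_prop))
  have e : ∀ γ s D u, varShift γ s D u =
      weight γ s u * (-(D ^ 2 / s ^ 2 * s) + 0 * u + D ^ 2 / s ^ 2 * γ * u ^ 2) := by
    intro γ s D u
    rw [varShift]
    ring
  refine ⟨fun ε hε => ?_, fun ε hε => ?_⟩
  · obtain ⟨r, hr, H⟩ := h.1 ε hε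
    refine ⟨r, hr, fun u u' s hs s' hs' γ hγ' D hD hu hd => ?_⟩
    rw [e, e]
    refine H u u' (s, γ, D) ⟨hs, hγ', hD⟩ (s', γ, D) ⟨hs', hγ', hD⟩ hu ?_
    simpa [Prod.dist_eq, Real.dist_eq, hr] using hd
  · obtain ⟨R, H⟩ := h.2 ε hε
    refine ⟨R, fun u s hs γ hγ' D hD hu => ?_⟩
    rw [e]
    exact H u (s, γ, D) ⟨hs, hγ', hD⟩ hu

end Box

/-! ### Perturbation of square roots -/

section Sqrt

/-- Only the reference value `b` has to be positive. When `a ≤ 0` the convention `√a = 0` still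
gives the bound, which covers the case of an empty interval. -/
lemma abs_sqrt_sub_sqrt_le_div {a b : ℝ} (hb : 0 < b) : |√a - √b| ≤ |a - b| / √b := by
  have hsb : 0 < √b := Real.sqrt_pos.2 hb
  rw [le_div_iff₀ hsb]
  rcases le_or_gt a 0 with ha | ha
  · rw [Real.sqrt_eq_zero_of_nonpos ha, zero_sub, abs_neg, abs_of_pos hsb, Real.mul_self_sqrt hb.le,
      abs_of_nonpos (by linarith)]
    linarith
  · have h : a - b = (√a - √b) * (√a + √b) := by
      nlinarith [Real.mul_self_sqrt ha.le, Real.mul_self_sqrt hb.le]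
    rw [h, abs_mul]
    gcongr
    rw [abs_of_nonneg (by positivity)]
    linarith [Real.sqrt_nonneg a]

/-- The Hölder version serves to compare `s̃` at two parameters, where neither `s̃²` is known to be
bounded away from zero. -/
lemma abs_sqrt_sub_sqrt_le_sqrt (a b : ℝ) : |√a - √b| ≤ √|a - b| := by
  have key : ∀ a b : ℝ, √a ≤ √b + √|a - b| := by
    intro a b
    rcases le_or_gt a 0 with ha | ha
    · rw [Real.sqrt_eq_zero_of_nonpos ha]
      positivity
    · rw [Real.sqrt_le_left (by positivity)]
      have h1 : b ≤ √b ^ 2 := by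
        rcases le_or_gt b 0 with hb | hb
        · nlinarith [sq_nonneg √b]
        · rw [Real.sq_sqrt hb.le]
      have h2 := Real.sq_sqrt (abs_nonneg (a - b))
      nlinarith [le_abs_self (a - b), mul_nonneg (Real.sqrt_nonneg b) (Real.sqrt_nonneg |a - b|)]
  rw [abs_sub_le_iff]
  constructor
  · linarith [key a b]
  · have := key b a
    rw [abs_sub_comm] at this
    linarith

end Sqrt

/-- First-order effect of `γ` on the weight. -/
lemma abs_weight_sub_one_le {s1 s2 : ℝ} (hs1 : 0 < s1) :
    ∃ K > 0, ∀ s ∈ Icc s1 s2, ∀ γ ∈ Icc (0 : ℝ) 1, ∀ u,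
      |weight γ s u - 1| ≤ K * γ * (1 + u ^ 2) ∧ weight γ s u ≤ K := by
  have hc : ContinuousOn (fun s => Real.log (2 * Real.pi * s)) (Icc s1 s2) := by
    refine ContinuousOn.log (by fun_prop) fun s hs => ?_
    have := hs1.trans_le hs.1
    positivity
  obtain ⟨L, hL⟩ := isCompact_Icc.exists_bound_of_continuousOn hc
  set L' := |L| with hL'
  have hL0 : 0 ≤ L' := abs_nonneg _
  refine ⟨(L' + 1 / (2 * s1)) * Real.exp L' + Real.exp L', by positivity, fun s hs γ hγ u => ?_⟩
  have hspos := hs1.trans_le hs.1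
  have hls : |Real.log (2 * Real.pi * s)| ≤ L' := (hL s hs).trans (le_abs_self L)
  -- The weight is `exp (-(γ t))`. The logarithmic part of `t` is bounded and the quadratic part is
  -- nonnegative, so `t ≥ -L'` bounds the weight while `|t| = O(1 + u²)` gives the first-order term.
  set t : ℝ := Real.log (2 * Real.pi * s) / (2 * (1 + γ)) + u ^ 2 / (2 * s) with ht
  have hw : weight γ s u = Real.exp (-(γ * t)) := by
    rw [weight, Real.rpow_def_of_pos (by positivity), ← Real.exp_add]
    congr 1
    rw [ht]
    ring
  have hγ0 := hγ.1
  have hq : |Real.log (2 * Real.pi * s) / (2 * (1 + γ))| ≤ L' := by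
    rw [abs_div, abs_of_pos (a := 2 * (1 + γ)) (by linarith)]
    exact (div_le_self (abs_nonneg _) (by linarith)).trans hls
  have hu0 : 0 ≤ u ^ 2 / (2 * s) := by positivity
  have hu1 : u ^ 2 / (2 * s) ≤ 1 / (2 * s1) * u ^ 2 := by
    rw [div_eq_inv_mul, one_div]
    gcongr
    exact hs.1
  have ht1 : -L' ≤ t := by linarith [(abs_le.1 hq).1]
  have ht2 : |t| ≤ (L' + 1 / (2 * s1)) * (1 + u ^ 2) := by
    have : |t| ≤ L' + 1 / (2 * s1) * u ^ 2 := by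
      refine (abs_add_le _ _).trans (add_le_add hq ?_)
      rwa [abs_of_nonneg hu0]
    have h3 : 0 ≤ L' * u ^ 2 := by positivity
    have h4 : 0 ≤ 1 / (2 * s1) := by positivity
    nlinarith
  have hexp : Real.exp (-(γ * t)) ≤ Real.exp L' := by
    apply Real.exp_le_exp.2
    nlinarith [hγ.2]
  have hmain : |Real.exp (-(γ * t)) - 1| ≤ γ * |t| * Real.exp L' := by
    have e1 := Real.add_one_le_exp (-(γ * t))
    have e2 := Real.add_one_le_exp (γ * t)
    have hE : 1 ≤ Real.exp L' := Real.one_le_exp hL0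
    have hpos := Real.exp_pos (-(γ * t))
    have hprod : Real.exp (γ * t) * Real.exp (-(γ * t)) = 1 := by
      rw [← Real.exp_add]; simp
    have h5 : Real.exp (-(γ * t)) - 1 ≤ -(γ * t) * Real.exp (-(γ * t)) := by nlinarith
    have hγt : |γ * t| = γ * |t| := by rw [abs_mul, abs_of_nonneg hγ0]
    have h6 : 0 ≤ γ * |t| := by positivity
    rw [abs_le]
    constructor
    · have := le_abs_self (γ * t)
      nlinarith
    · have := neg_abs_le (γ * t)
      calc _ ≤ -(γ * t) * Real.exp (-(γ * t)) := h5
        _ ≤ (γ * |t|) * Real.exp (-(γ * t)) := by gcongr; linarith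
        _ ≤ _ := by gcongr
  constructor
  · rw [hw]
    refine hmain.trans ?_
    calc γ * |t| * Real.exp L' ≤ γ * ((L' + 1 / (2 * s1)) * (1 + u ^ 2)) * Real.exp L' := by gcongr
      _ = ((L' + 1 / (2 * s1)) * Real.exp L') * (γ * (1 + u ^ 2)) := by ring
      _ ≤ ((L' + 1 / (2 * s1)) * Real.exp L' + Real.exp L') * (γ * (1 + u ^ 2)) := by
          gcongr
          linarith [Real.exp_pos L']
      _ = _ := by ring
  · rw [hw]
    have : 0 ≤ (L' + 1 / (2 * s1)) * Real.exp L' := by positivity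
    linarith

section Measure

variable {Ω : Type*} [MeasurableSpace Ω]

lemma abs_measureReal_sub_le {μ : Measure Ω} [IsFiniteMeasure μ] {S T B : Set Ω}
    (h : ∀ x, x ∉ B → (x ∈ S ↔ x ∈ T)) : |μ.real S - μ.real T| ≤ μ.real B := by
  have h1 : μ.real S ≤ μ.real T + μ.real B :=
    (measureReal_mono (fun x hx => by
      by_cases hB : x ∈ B
      · exact Or.inr hB
      · exact Or.inl ((h x hB).1 hx))).trans (measureReal_union_le T B)
  have h2 : μ.real T ≤ μ.real S + μ.real B :=
    (measureReal_mono (fun x hx => by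
      by_cases hB : x ∈ B
      · exact Or.inr hB
      · exact Or.inl ((h x hB).2 hx))).trans (measureReal_union_le S B)
  rw [abs_le]
  constructor <;> linarith

end Measure

/-! ### Normal laws: intervals, quantiles, moments and Bayes' formula -/

section Gaussian

lemma gaussianReal_real_Icc_le {v : ℝ} (hv : 0 < v) (c a b : ℝ) (hab : a ≤ b) :
    (gaussianReal c v.toNNReal).real (Icc a b) ≤ (b - a) / √(2 * Real.pi * v) := by
  have hv' : v.toNNReal ≠ 0 := (Real.toNNReal_pos.2 hv).ne'
  have h1 : ∀ x, gaussianPDF c v.toNNReal x ≤ ENNReal.ofReal (√(2 * Real.pi * v))⁻¹ := by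
    intro x
    rw [gaussianPDF]
    refine ENNReal.ofReal_le_ofReal ?_
    rw [gaussianPDFReal_def, Real.coe_toNNReal _ hv.le]
    refine mul_le_of_le_one_right (by positivity) (Real.exp_le_one_iff.2 ?_)
    exact div_nonpos_of_nonpos_of_nonneg (by nlinarith [sq_nonneg (x - c)]) (by positivity)
  rw [measureReal_def, gaussianReal_apply c hv']
  refine ENNReal.toReal_le_of_le_ofReal (by have := sub_nonneg.2 hab; positivity) ?_
  calc ∫⁻ x in Icc a b, gaussianPDF c v.toNNReal x
      ≤ ∫⁻ _ in Icc a b, ENNReal.ofReal (√(2 * Real.pi * v))⁻¹ := lintegral_mono h1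
    _ = _ := by
      rw [lintegral_const, Measure.restrict_apply_univ, Real.volume_Icc,
        ← ENNReal.ofReal_mul (by positivity)]
      congr 1
      ring

lemma gaussianReal_real_band_le {v : ℝ} (hv : 0 < v) (c a h r : ℝ) (hr : 0 ≤ r) :
    (gaussianReal c v.toNNReal).real {t | |(|t - a| - h)| ≤ r} ≤ 4 * r / √(2 * Real.pi * v) := by
  have hsub : {t | |(|t - a| - h)| ≤ r} ⊆
      Icc (a - h - r) (a - h + r) ∪ Icc (a + h - r) (a + h + r) := by
    intro t ht
    simp only [mem_ofPred_eq, abs_le] at ht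
    rcases abs_cases (t - a) with ⟨h1, -⟩ | ⟨h1, -⟩ <;> rw [h1] at ht
    · exact Or.inr ⟨by linarith, by linarith⟩
    · exact Or.inl ⟨by linarith, by linarith⟩
  refine (measureReal_mono hsub).trans ((measureReal_union_le _ _).trans ?_)
  refine (add_le_add (gaussianReal_real_Icc_le hv c _ _ (by linarith))
    (gaussianReal_real_Icc_le hv c _ _ (by linarith))).trans (le_of_eq ?_)
  ring

/-- Replacing `(a, h)` by `(c, h0)` changes `|t - a| - h` by at most `r`, so membership can flip
only when `|t - c|` is within `r` of `h0`. The half-widths may have any sign. -/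
lemma mem_interval_iff_of_notMem_band {t a h c h0 r : ℝ} (hr : |a - c| + |h - h0| ≤ r)
    (hB : ¬ |(|t - c| - h0)| ≤ r) : |t - a| < h ↔ |t - c| < h0 := by
  have h1 : |(|t - a| - |t - c|)| ≤ |a - c| := by
    have := abs_abs_sub_abs_le_abs_sub (t - a) (t - c)
    rwa [show t - a - (t - c) = -(a - c) by ring, abs_neg] at this
  have h2 := abs_le.1 h1
  have h3 := abs_le.1 (le_refl |h - h0|)
  rw [not_le, lt_abs] at hB
  constructor
  · intro h4
    rcases hB with hB | hB <;> linarith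
  · intro h4
    rcases hB with hB | hB <;> linarith

/-- This converts errors in centre and half-width into errors in coverage: the two intervals
disagree inside a band of length `O(r)`, and the density is bounded. -/
lemma abs_gaussianReal_interval_sub_le {v : ℝ} (hv : 0 < v) (c' a h c h0 : ℝ) :
    |(gaussianReal c' v.toNNReal).real {t | |t - a| < h} -
      (gaussianReal c' v.toNNReal).real {t | |t - c| < h0}| ≤
      4 * (|a - c| + |h - h0|) / √(2 * Real.pi * v) :=
  (abs_measureReal_sub_le fun _ ht => mem_interval_iff_of_notMem_band le_rfl ht).trans
    (gaussianReal_real_band_le hv c' c h0 _ (by positivity))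

lemma gaussianReal_eq_map_std {v : ℝ} (hv : 0 ≤ v) (c : ℝ) :
    gaussianReal c v.toNNReal = (gaussianReal 0 1).map fun x => √v * x + c := by
  rw [show (fun x => √v * x + c) = (fun x => x + c) ∘ (fun x => √v * x) from rfl,
    ← Measure.map_map (by fun_prop) (by fun_prop), gaussianReal_map_const_mul,
    gaussianReal_map_add_const]
  congr 1
  · simp
  · ext
    simp [Real.sq_sqrt hv, hv]

/-- The upper tail is Lipschitz, has limits `1` and `0`, and is strictly decreasing because the
normal law charges every nondegenerate interval. Hence the set defining `zUpper a` is a closed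
half-line whose endpoint has tail exactly `a`. -/
lemma gaussianReal_real_Ioi_zUpper {a : ℝ} (ha : a ∈ Ioo (0 : ℝ) 1) :
    (gaussianReal 0 1).real (Ioi (zUpper a)) = a := by
  set μ := gaussianReal 0 1 with hμ
  have hone : (1 : ℝ).toNNReal = 1 := by simp
  have hstep : ∀ s t, s ≤ t → μ.real (Ioi s) = μ.real (Ioi t) + μ.real (Ioc s t) := by
    intro s t hst
    rw [← Ioc_union_Ioi_eq_Ioi hst, measureReal_union _ measurableSet_Ioi]
    · ring
    · exact Set.disjoint_left.2 fun x hx hx' => not_lt.2 hx.2 hx'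
  have hIoc : ∀ s t, s ≤ t → μ.real (Ioc s t) ≤ (t - s) / √(2 * Real.pi) := by
    intro s t hst
    have := gaussianReal_real_Icc_le one_pos 0 s t hst
    rw [hone, mul_one] at this
    exact (measureReal_mono Ioc_subset_Icc_self).trans this
  have hcont : Continuous fun s => μ.real (Ioi s) := by
    have hL : LipschitzWith (Real.toNNReal (1 / √(2 * Real.pi))) fun s => μ.real (Ioi s) := by
      refine LipschitzWith.of_le_add_mul _ fun s t => ?_
      rw [Real.coe_toNNReal _ (by positivity), Real.dist_eq]
      rcases le_total s t with h | h
      · rw [hstep s t h, abs_of_nonpos (by linarith)]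
        have := hIoc s t h
        rw [div_eq_mul_one_div] at this
        linarith
      · rw [hstep t s h]
        have : 0 ≤ 1 / √(2 * Real.pi) * |s - t| := by positivity
        have h2 : 0 ≤ μ.real (Ioc t s) := measureReal_nonneg
        linarith
    exact hL.continuous
  have hcdf : ∀ s, μ.real (Ioi s) = 1 - cdf μ s := by
    intro s
    rw [cdf_eq_real, ← compl_Iic, probReal_compl_eq_one_sub measurableSet_Iic]
  have htop : Tendsto (fun s => μ.real (Ioi s)) atTop (𝓝 0) := by
    simp only [hcdf]
    simpa using (tendsto_cdf_atTop μ).const_sub 1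
  have hbot : Tendsto (fun s => μ.real (Ioi s)) atBot (𝓝 1) := by
    simp only [hcdf]
    simpa using (tendsto_cdf_atBot μ).const_sub 1
  obtain ⟨s0, hs0⟩ : ∃ s, μ.real (Ioi s) = a := by
    obtain ⟨s1, h1⟩ := (htop.eventually (gt_mem_nhds ha.1)).exists
    obtain ⟨s2, h2⟩ := (hbot.eventually (lt_mem_nhds ha.2)).exists
    exact mem_range_of_exists_le_of_exists_ge hcont ⟨s1, h1.le⟩ ⟨s2, h2.le⟩
  have hset : {z : ℝ | μ (Ioi z) ≤ ENNReal.ofReal a} = Ici s0 := by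
    ext z
    rw [mem_ofPred_eq, mem_Ici, ENNReal.le_ofReal_iff_toReal_le (measure_ne_top _ _) ha.1.le,
      ← measureReal_def]
    constructor
    · intro hz
      by_contra! hlt
      have hpos : 0 < μ.real (Ioc z s0) := by
        have h1 : μ (Ioc z s0) ≠ 0 := by
          intro h0
          have := gaussianReal_absolutelyContinuous' 0 (one_ne_zero) h0
          rw [Real.volume_Ioc, ENNReal.ofReal_eq_zero] at this
          linarith
        exact ENNReal.toReal_pos h1 (measure_ne_top _ _)
      have := hstep z s0 hlt.le
      linarith
    · intro hz
      have := hstep s0 z hz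
      have h2 : 0 ≤ μ.real (Ioc s0 z) := measureReal_nonneg
      linarith
  rw [zUpper, ← hμ, hset, csInf_Ici, hs0]

lemma gaussianReal_std_real_interval {α : ℝ} (hα : α ∈ Ioo (0 : ℝ) 1) :
    (gaussianReal 0 1).real (Ioo (-zUpper (α / 2)) (zUpper (α / 2))) = 1 - α := by
  have hα2 : α / 2 ∈ Ioo (0 : ℝ) 1 := ⟨by linarith [hα.1], by linarith [hα.2]⟩
  have hz := gaussianReal_real_Ioi_zUpper hα2
  set z := zUpper (α / 2)
  set μ := gaussianReal 0 1 with hμ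
  have : NullSingletonClass μ := nullSingletonClass_gaussianReal one_ne_zero
  have hneg : ∀ t, μ.real (Iio (-t)) = μ.real (Ioi t) := by
    intro t
    have h : μ.map (fun x => -x) = μ := by rw [hμ, gaussianReal_map_neg, neg_zero]
    conv_lhs => rw [← h]
    rw [map_measureReal_apply (by fun_prop) measurableSet_Iio]
    congr 1
    ext x
    simp
  have hIci : ∀ t, μ.real (Ici t) = μ.real (Ioi t) := fun t => measureReal_congr Ioi_ae_eq_Ici.symm
  have hIic : ∀ t, μ.real (Iic t) = μ.real (Iio t) := fun t => measureReal_congr Iio_ae_eq_Iic.symm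
  -- By symmetry the tail beyond `0` is at least `1/2`, whereas the tail beyond `z` is `α/2 < 1/2`.
  have hz0 : 0 ≤ z := by
    by_contra! hlt
    have h1 : μ.real (Ioi 0) ≤ μ.real (Ioi z) := measureReal_mono (Ioi_subset_Ioi hlt.le)
    have h2 := probReal_add_probReal_compl (μ := μ) (measurableSet_Ioi (a := (0 : ℝ)))
    rw [compl_Ioi, hIic] at h2
    have h3 := hneg 0
    rw [neg_zero] at h3
    linarith [hα.2]
  have h1 := probReal_add_probReal_compl (μ := μ) (measurableSet_Ioi (a := -z))
  rw [compl_Ioi, hIic, hneg] at h1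
  rcases hz0.eq_or_lt with h0 | h0
  · rw [← h0] at h1 hz
    rw [neg_zero] at h1
    linarith [hα.2]
  have h2 : μ.real (Ioi (-z)) = μ.real (Ioo (-z) z) + μ.real (Ici z) := by
    rw [← Ioo_union_Ici_eq_Ioi (show -z < z by linarith), measureReal_union _ measurableSet_Ici]
    exact Set.disjoint_left.2 fun x hx hx' => not_le.2 hx.2 hx'
  rw [hIci] at h2
  linarith

lemma gaussianReal_real_interval {α v : ℝ} (hα : α ∈ Ioo (0 : ℝ) 1) (hv : 0 < v) (c : ℝ) :
    (gaussianReal c v.toNNReal).real {t | |t - c| < zUpper (α / 2) * √v} = 1 - α := by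
  rw [← gaussianReal_std_real_interval hα, gaussianReal_eq_map_std hv.le,
    map_measureReal_apply (by fun_prop) (measurableSet_lt (by fun_prop) (by fun_prop))]
  congr 1
  ext t
  have hsv := Real.sqrt_pos.2 hv
  rw [mem_preimage, mem_ofPred_eq, add_sub_cancel_right, abs_mul, abs_of_pos hsv, mul_comm,
    mul_lt_mul_iff_left₀ hsv, mem_Ioo, abs_lt]

/-- Gaussian moments of the residual, uniformly over bounded variances. -/
lemma exists_gaussianReal_moment_bound (s2 : ℝ) :
    ∃ M > 0, ∀ μ : ℝ, ∀ s, 0 ≤ s → s ≤ s2 →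
      Integrable (fun y => 1 + |y - μ| ^ 3) (gaussianReal μ s.toNNReal) ∧
      ∫ y, (1 + |y - μ| ^ 3) ∂(gaussianReal μ s.toNNReal) ≤ M := by
  have hint : Integrable (fun y : ℝ => |y| ^ 3) (gaussianReal 0 1) := by
    have := (memLp_id_gaussianReal (μ := 0) (v := 1) 3).integrable_norm_pow (p := 3) (by norm_num)
    simpa using this
  refine ⟨1 + √s2 ^ 3 * ∫ y, |y| ^ 3 ∂(gaussianReal 0 1), ?_, fun μ s hs hs2 => ?_⟩
  · have : 0 ≤ ∫ y, |y| ^ 3 ∂(gaussianReal 0 1) := integral_nonneg fun y => by positivity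
    positivity
  · have he : (fun y => 1 + |y - μ| ^ 3) ∘ (fun x => √s * x + μ) =
        fun x => 1 + √s ^ 3 * |x| ^ 3 := by
      funext x
      simp [abs_mul, mul_pow, abs_of_nonneg (Real.sqrt_nonneg s)]
    have hi2 : Integrable (fun x : ℝ => 1 + √s ^ 3 * |x| ^ 3) (gaussianReal 0 1) :=
      (integrable_const 1).add (hint.const_mul _)
    rw [gaussianReal_eq_map_std hs, integrable_map_measure (by fun_prop) (by fun_prop), he,
      integral_map (by fun_prop) (by fun_prop)]
    refine ⟨hi2, ?_⟩
    rw [show ∫ x, (1 + |√s * x + μ - μ| ^ 3) ∂(gaussianReal 0 1) =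
      ∫ x, (1 + √s ^ 3 * |x| ^ 3) ∂(gaussianReal 0 1) from congrArg (fun f => ∫ x, f x ∂_) he,
      integral_add (integrable_const 1) (hint.const_mul _), integral_const_mul]
    simp only [integral_const, probReal_univ, smul_eq_mul, one_mul]
    have : 0 ≤ ∫ y, |y| ^ 3 ∂(gaussianReal 0 1) := integral_nonneg fun y => by positivity
    gcongr

/-- Bayes' formula for the normal model. -/
lemma gaussianPDFReal_mul_gaussianPDFReal {A D : ℝ} (hA : 0 < A) (hD : 0 < D) (μ θ y : ℝ) :
    gaussianPDFReal μ A.toNNReal θ * gaussianPDFReal θ D.toNNReal y =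
      gaussianPDFReal μ (A + D).toNNReal y *
        gaussianPDFReal (y - D / (A + D) * (y - μ)) (A * D / (A + D)).toNNReal θ := by
  have hs : 0 < A + D := by positivity
  have hv : 0 < A * D / (A + D) := by positivity
  simp only [gaussianPDFReal_def, Real.coe_toNNReal _ hA.le, Real.coe_toNNReal _ hD.le,
    Real.coe_toNNReal _ hs.le, Real.coe_toNNReal _ hv.le]
  have h1 : (√(2 * Real.pi * A))⁻¹ * (√(2 * Real.pi * D))⁻¹ =
      (√(2 * Real.pi * (A + D)))⁻¹ * (√(2 * Real.pi * (A * D / (A + D))))⁻¹ := by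
    rw [← mul_inv, ← mul_inv, ← Real.sqrt_mul (by positivity), ← Real.sqrt_mul (by positivity)]
    congr 2
    field_simp
  rw [mul_mul_mul_comm, h1, mul_mul_mul_comm _ (Real.exp _), ← Real.exp_add, ← Real.exp_add]
  congr 2
  field_simp
  ring

lemma measurable_gaussianPDFReal_comp {X : Type*} [MeasurableSpace X] {f g : X → ℝ} {v : ℝ≥0}
    (hf : Measurable f) (hg : Measurable g) :
    Measurable fun x => gaussianPDFReal (f x) v (g x) := by
  unfold gaussianPDFReal
  fun_prop

/-- Fubini combined with Bayes' formula: the order `θ`, then `y` given `θ`, becomes `y`, then the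
normal posterior of `θ` given `y`. -/
lemma integral_integral_gaussianReal_swap {A D : ℝ} (hA : 0 < A) (hD : 0 < D) (μ : ℝ)
    {f : ℝ → ℝ → ℝ} (hf : Measurable (Function.uncurry f)) {B : ℝ} (hB : ∀ θ y, |f θ y| ≤ B) :
    ∫ θ, ∫ y, f θ y ∂(gaussianReal θ D.toNNReal) ∂(gaussianReal μ A.toNNReal) =
      ∫ y, ∫ θ, f θ y ∂(gaussianReal (y - D / (A + D) * (y - μ)) (A * D / (A + D)).toNNReal)
        ∂(gaussianReal μ (A + D).toNNReal) := by
  have hs : 0 < A + D := by positivity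
  have hv : 0 < A * D / (A + D) := by positivity
  have nz : ∀ {t : ℝ}, 0 < t → t.toNNReal ≠ 0 := fun h => (Real.toNNReal_pos.2 h).ne'
  simp only [integral_gaussianReal_eq_integral_smul (nz hA),
    integral_gaussianReal_eq_integral_smul (nz hD), integral_gaussianReal_eq_integral_smul (nz hs),
    integral_gaussianReal_eq_integral_smul (nz hv), smul_eq_mul, ← integral_const_mul, ← mul_assoc]
  simp only [← gaussianPDFReal_mul_gaussianPDFReal hA hD]
  refine integral_integral_swap ?_
  have hm : Measurable fun z : ℝ × ℝ =>
      gaussianPDFReal μ A.toNNReal z.1 * gaussianPDFReal z.1 D.toNNReal z.2 :=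
    (measurable_gaussianPDFReal_comp measurable_const measurable_fst).mul
      (measurable_gaussianPDFReal_comp measurable_fst measurable_snd)
  have hint : Integrable (fun z : ℝ × ℝ =>
      gaussianPDFReal μ A.toNNReal z.1 * gaussianPDFReal z.1 D.toNNReal z.2)
      (volume.prod volume) := by
    rw [integrable_prod_iff hm.aestronglyMeasurable]
    refine ⟨Eventually.of_forall fun θ =>
      (integrable_gaussianPDFReal θ D.toNNReal).const_mul (gaussianPDFReal μ A.toNNReal θ), ?_⟩
    refine (integrable_gaussianPDFReal μ A.toNNReal).congr (Eventually.of_forall fun θ => ?_)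
    simp only [norm_mul, Real.norm_eq_abs, abs_of_nonneg (gaussianPDFReal_nonneg _ _ _)]
    rw [integral_const_mul, integral_gaussianPDFReal_eq_one _ (nz hD), mul_one]
  exact hint.mul_bdd (c := B) hf.aestronglyMeasurable (Eventually.of_forall fun z => hB z.1 z.2)

end Gaussian

/-! ### The mean weight and its maximizer -/

section PopulationWeight

/-- The mean of the weight `w_γ` with parameters `(μ, s)` under `N(μ', s')`, as a function of
`d = μ' - μ`. -/
def popWeight (γ s' s d : ℝ) : ℝ :=
  (2 * Real.pi * s) ^ (-(γ / (2 * (1 + γ)))) * √(s / (s + γ * s')) *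
    Real.exp (-(γ * d ^ 2) / (2 * (s + γ * s')))

/-- Up to a constant, the weight is a normal density of variance `s / γ`. Its mean under `N(μ', s')`
is therefore a convolution of normals, read off from Bayes' formula with prior variance `s'` and
sampling variance `s / γ`. -/
lemma integral_weight_gaussianReal {γ s s' : ℝ} (hγ : 0 < γ) (hs : 0 < s) (hs' : 0 < s')
    (μ μ' : ℝ) :
    ∫ y, weight γ s (y - μ) ∂(gaussianReal μ' s'.toNNReal) = popWeight γ s' s (μ' - μ) := by
  have hD : 0 < s / γ := by positivity
  have hv : 0 < s' * (s / γ) / (s' + s / γ) := by positivity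
  have ht : 0 < s' + s / γ := by positivity
  have nz : ∀ {t : ℝ}, 0 < t → t.toNNReal ≠ 0 := fun h => (Real.toNNReal_pos.2 h).ne'
  have hw : ∀ y, weight γ s (y - μ) = (2 * Real.pi * s) ^ (-(γ / (2 * (1 + γ)))) *
      √(2 * Real.pi * (s / γ)) * gaussianPDFReal y (s / γ).toNNReal μ := by
    intro y
    have h0 : √(2 * Real.pi * (s / γ)) ≠ 0 := by positivity
    rw [weight, gaussianPDFReal_def, Real.coe_toNNReal _ hD.le]
    beta_reduce
    rw [mul_assoc (_ ^ _) (√_), mul_inv_cancel_left₀ h0]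
    congr 2
    field_simp
    ring
  rw [integral_gaussianReal_eq_integral_smul (nz hs')]
  simp only [hw, smul_eq_mul]
  have h2 : ∀ y, gaussianPDFReal μ' s'.toNNReal y *
      ((2 * Real.pi * s) ^ (-(γ / (2 * (1 + γ)))) * √(2 * Real.pi * (s / γ)) *
        gaussianPDFReal y (s / γ).toNNReal μ) =
      ((2 * Real.pi * s) ^ (-(γ / (2 * (1 + γ)))) * √(2 * Real.pi * (s / γ)) *
        gaussianPDFReal μ' (s' + s / γ).toNNReal μ) *
      gaussianPDFReal (μ - s / γ / (s' + s / γ) * (μ - μ'))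
        (s' * (s / γ) / (s' + s / γ)).toNNReal y := by
    intro y
    rw [mul_assoc _ (gaussianPDFReal μ' _ _), ← gaussianPDFReal_mul_gaussianPDFReal hs' hD]
    ring
  simp only [h2]
  rw [integral_const_mul, integral_gaussianPDFReal_eq_one _ (nz hv), mul_one, popWeight,
    gaussianPDFReal_def, Real.coe_toNNReal _ ht.le]
  beta_reduce
  rw [mul_assoc (_ ^ _) (√_), mul_assoc (_ ^ _) (√_), ← mul_assoc (√_)]
  congr 2
  · rw [← Real.sqrt_inv, ← Real.sqrt_mul (by positivity)]
    congr 1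
    field_simp
    ring
  · congr 1
    field_simp
    ring

lemma popWeight_pos {γ s s' d : ℝ} (hγ : 0 < γ) (hs : 0 < s) (hs' : 0 < s') :
    0 < popWeight γ s' s d := by
  unfold popWeight
  positivity

/-- Up to a constant, the logarithm is half of `log t / (1 + γ) - log (t + γ s')`. Strict concavity
of `log` at the average of `s` and `s'` with weights `1/(1+γ)` and `γ/(1+γ)` puts the unique maximum
at `t = s'`. The exponent in `c_γ` is what produces this balance. -/
lemma popWeight_zero_lt {γ s s' : ℝ} (hγ : 0 < γ) (hs : 0 < s) (hs' : 0 < s') (hne : s ≠ s') :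
    popWeight γ s' s 0 < popWeight γ s' s' 0 := by
  rw [← Real.log_lt_log_iff (popWeight_pos hγ hs hs') (popWeight_pos hγ hs' hs')]
  have hl : ∀ t, 0 < t → Real.log (popWeight γ s' t 0) =
      -(γ / (2 * (1 + γ))) * (Real.log (2 * Real.pi) + Real.log t) +
        (Real.log t - Real.log (t + γ * s')) / 2 := by
    intro t ht
    have h1 : 0 < t + γ * s' := by positivity
    rw [popWeight]
    simp only [ne_eq, OfNat.ofNat_ne_zero, not_false_eq_true, zero_pow, mul_zero, neg_zero,
      zero_div, Real.exp_zero, mul_one]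
    rw [Real.log_mul (by positivity) (by positivity), Real.log_rpow (by positivity),
      Real.log_mul (by positivity) ht.ne', Real.log_sqrt (by positivity),
      Real.log_div ht.ne' h1.ne']
  rw [hl s hs, hl s' hs']
  have hc0 := strictConcaveOn_log_Ioi.2
  have hc := hc0 (mem_Ioi.2 hs) (mem_Ioi.2 hs') hne (show 0 < 1 / (1 + γ) by positivity)
    (show 0 < γ / (1 + γ) by positivity) (by field_simp)
  simp only [smul_eq_mul] at hc
  have e1 : 1 / (1 + γ) * s + γ / (1 + γ) * s' = (s + γ * s') / (1 + γ) := by field_simp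
  have hp : 0 < s + γ * s' := by positivity
  rw [e1, Real.log_div hp.ne' (by positivity)] at hc
  rw [show s' + γ * s' = s' * (1 + γ) by ring, Real.log_mul hs'.ne' (by positivity)]
  have e2 : γ / (2 * (1 + γ)) = (γ / (1 + γ)) / 2 := by field_simp
  have e3 : 1 / (1 + γ) = 1 - γ / (1 + γ) := by field_simp; ring
  rw [e3] at hc
  rw [e2]
  linarith

lemma popWeight_lt_of_ne {γ s s' d : ℝ} (hγ : 0 < γ) (hs : 0 < s) (hs' : 0 < s')
    (hd : d ≠ 0) : popWeight γ s' s d < popWeight γ s' s 0 := by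
  unfold popWeight
  have h1 : 0 < s + γ * s' := by positivity
  have h2 : 0 < d ^ 2 := by positivity
  gcongr ?_ * Real.exp ?_
  have h3 : 0 < γ * d ^ 2 := by positivity
  simpa using div_neg_of_neg_of_pos (neg_lt_zero.2 h3) (by positivity)

lemma popWeight_le {γ s s' d : ℝ} (hγ : 0 < γ) (hs : 0 < s) (hs' : 0 < s') :
    popWeight γ s' s d ≤ popWeight γ s' s' 0 := by
  have h1 : popWeight γ s' s d ≤ popWeight γ s' s 0 := by
    rcases eq_or_ne d 0 with rfl | hd
    · exact le_rfl
    · exact (popWeight_lt_of_ne hγ hs hs' hd).le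
  refine h1.trans ?_
  rcases eq_or_ne s s' with rfl | hne
  · exact le_rfl
  · exact (popWeight_zero_lt hγ hs hs' hne).le

lemma popWeight_eq_iff {γ s s' d : ℝ} (hγ : 0 < γ) (hs : 0 < s) (hs' : 0 < s') :
    popWeight γ s' s d = popWeight γ s' s' 0 ↔ s = s' ∧ d = 0 := by
  refine ⟨fun h => ?_, fun ⟨h1, h2⟩ => by rw [h1, h2]⟩
  by_contra hne
  have hle : popWeight γ s' s 0 ≤ popWeight γ s' s' 0 := popWeight_le hγ hs hs'
  rcases eq_or_ne d 0 with rfl | hd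
  · exact (popWeight_zero_lt hγ hs hs' fun h => hne ⟨h, rfl⟩).ne h
  · exact ((popWeight_lt_of_ne hγ hs hs' hd).trans_le hle).ne h

end PopulationWeight

/-! ### The linear predictor -/

section Lin

lemma lin_eq_inner (x β : Cov p) : lin x β = inner ℝ β x := by
  simp [lin, PiLp.inner_apply]

lemma abs_lin_le (x β : Cov p) : |lin x β| ≤ ‖x‖ * ‖β‖ := by
  rw [lin_eq_inner, mul_comm]
  exact abs_real_inner_le_norm β x

lemma abs_lin_sub_le (x β β' : Cov p) : |lin x β - lin x β'| ≤ ‖x‖ * ‖β - β'‖ := by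
  rw [lin_eq_inner, lin_eq_inner, ← inner_sub_left, mul_comm]
  exact abs_real_inner_le_norm _ x

lemma measurable_lin {X : Type*} [MeasurableSpace X] {f : X → Cov p} (hf : Measurable f)
    (β : Cov p) : Measurable fun z => lin (f z) β := by
  unfold lin
  fun_prop

end Lin

/-! ### Disintegration of the law of one area -/

section AreaLaw

instance : IsMarkovKernel (obsKernel p) :=
  ⟨fun z => inferInstanceAs (IsProbabilityMeasure (gaussianReal z.2 z.1.2.toNNReal))⟩

lemma isMarkovKernel_thetaKernel (β : Cov p) (A : ℝ) {ω : ℝ} (hω : ω ∈ Icc (0 : ℝ) 1)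
    (δ : Measure ℝ) [IsProbabilityMeasure δ] : IsMarkovKernel (thetaKernel β A ω δ) := by
  refine ⟨fun z => ⟨?_⟩⟩
  change (ENNReal.ofReal (1 - ω) • gaussianReal (lin z.1 β) A.toNNReal +
    ENNReal.ofReal ω • δ) univ = 1
  simp only [Measure.coe_add, Measure.coe_smul, Pi.add_apply, Pi.smul_apply, measure_univ,
    smul_eq_mul, mul_one]
  rw [← ENNReal.ofReal_add (by linarith [hω.2]) hω.1]
  simp

lemma isProbabilityMeasure_areaLaw (ν : Measure (Cov p × ℝ)) [IsProbabilityMeasure ν] (β : Cov p)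
    (A : ℝ) {ω : ℝ} (hω : ω ∈ Icc (0 : ℝ) 1) (δ : Measure ℝ) [IsProbabilityMeasure δ] :
    IsProbabilityMeasure (areaLaw ν β A ω δ) := by
  have := isMarkovKernel_thetaKernel β A hω δ
  unfold areaLaw
  infer_instance

lemma ae_areaLaw {ν : Measure (Cov p × ℝ)} [IsProbabilityMeasure ν] (β : Cov p)
    (A : ℝ) {ω : ℝ} (hω : ω ∈ Icc (0 : ℝ) 1) (δ : Measure ℝ) [IsProbabilityMeasure δ]
    {q : Cov p × ℝ → Prop} (hq : ∀ᵐ z ∂ν, q z) : ∀ᵐ t ∂(areaLaw ν β A ω δ), q t.1.1 := by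
  have := isMarkovKernel_thetaKernel β A hω δ
  have h1 : (areaLaw ν β A ω δ).fst.fst = ν := by
    rw [areaLaw, Measure.fst_compProd, Measure.fst_compProd]
  rw [← h1] at hq
  exact ae_of_ae_map measurable_fst.aemeasurable (ae_of_ae_map measurable_fst.aemeasurable hq)

/-- The conditional mean of `f` given `(x, D) = z`, when `θ` has law `τ`. -/
def condMean (f : ((Cov p × ℝ) × ℝ) × ℝ → ℝ) (τ : Measure ℝ) (z : Cov p × ℝ) : ℝ :=
  ∫ θ, ∫ y, f ((z, θ), y) ∂(gaussianReal θ z.2.toNNReal) ∂τ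

/-- The two composition products unfold into iterated integrals, and integration against the mixture
is linear, so clean and contaminated parts can be estimated separately. -/
lemma integral_areaLaw (ν : Measure (Cov p × ℝ)) [IsProbabilityMeasure ν] (β : Cov p)
    (A : ℝ) {ω : ℝ} (hω : ω ∈ Icc (0 : ℝ) 1) (δ : Measure ℝ) [IsProbabilityMeasure δ]
    {f : ((Cov p × ℝ) × ℝ) × ℝ → ℝ} (hf : Measurable f) {B : ℝ} (hB : ∀ t, |f t| ≤ B) :
    Integrable (fun z => (1 - ω) * condMean f (gaussianReal (lin z.1 β) A.toNNReal) z +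
      ω * condMean f δ z) ν ∧
    ∫ t, f t ∂(areaLaw ν β A ω δ) =
      ∫ z, ((1 - ω) * condMean f (gaussianReal (lin z.1 β) A.toNNReal) z +
        ω * condMean f δ z) ∂ν := by
  have := isMarkovKernel_thetaKernel β A hω δ
  have hprob := isProbabilityMeasure_areaLaw ν β A hω δ
  have hfi : Integrable f (areaLaw ν β A ω δ) :=
    Integrable.of_bound hf.aestronglyMeasurable B (Eventually.of_forall hB)
  unfold areaLaw at hfi ⊢
  have hg : StronglyMeasurable fun s : (Cov p × ℝ) × ℝ => ∫ y, f (s, y) ∂(obsKernel p s) :=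
    hf.stronglyMeasurable.integral_kernel_prod_right'
  have hgB : ∀ s : (Cov p × ℝ) × ℝ, ‖∫ y, f (s, y) ∂(obsKernel p s)‖ ≤ B := fun s => by
    have := norm_integral_le_of_norm_le_const (μ := obsKernel p s) (f := fun y => f (s, y))
      (Eventually.of_forall fun y => hB (s, y))
    simpa using this
  have hgi : Integrable (fun s : (Cov p × ℝ) × ℝ => ∫ y, f (s, y) ∂(obsKernel p s))
      (ν ⊗ₘ thetaKernel β A ω δ) :=
    Integrable.of_bound hg.aestronglyMeasurable B (Eventually.of_forall hgB)
  have key : ∀ z : Cov p × ℝ, ∫ θ, ∫ y, f ((z, θ), y) ∂(obsKernel p (z, θ))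
      ∂(thetaKernel β A ω δ z) =
      (1 - ω) * condMean f (gaussianReal (lin z.1 β) A.toNNReal) z + ω * condMean f δ z := by
    intro z
    have hm : StronglyMeasurable fun θ => ∫ y, f ((z, θ), y) ∂(obsKernel p (z, θ)) :=
      hg.comp_measurable measurable_prodMk_left
    have hi : ∀ τ : Measure ℝ, IsFiniteMeasure τ →
        Integrable (fun θ => ∫ y, f ((z, θ), y) ∂(obsKernel p (z, θ))) τ := fun τ _ =>
      Integrable.of_bound hm.aestronglyMeasurable B (Eventually.of_forall fun θ => hgB (z, θ))
    change ∫ θ, ∫ y, f ((z, θ), y) ∂(obsKernel p (z, θ))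
      ∂(ENNReal.ofReal (1 - ω) • gaussianReal (lin z.1 β) A.toNNReal + ENNReal.ofReal ω • δ) = _
    rw [integral_add_measure ((hi _ inferInstance).smul_measure ENNReal.ofReal_ne_top)
      ((hi _ inferInstance).smul_measure ENNReal.ofReal_ne_top), integral_smul_measure,
      integral_smul_measure, ENNReal.toReal_ofReal (by linarith [hω.2]), ENNReal.toReal_ofReal hω.1]
    rfl
  have hgi2 : Integrable (fun z => ∫ θ, ∫ y, f ((z, θ), y) ∂(obsKernel p (z, θ))
      ∂(thetaKernel β A ω δ z)) ν := hgi.integral_compProd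
  rw [Measure.integral_compProd hfi, Measure.integral_compProd hgi]
  simp only [key] at hgi2 ⊢
  exact ⟨hgi2, trivial⟩

lemma abs_integral_areaLaw_le (ν : Measure (Cov p × ℝ)) [IsProbabilityMeasure ν] (β : Cov p)
    (A : ℝ) {ω : ℝ} (hω : ω ∈ Icc (0 : ℝ) 1) (δ : Measure ℝ) [IsProbabilityMeasure δ]
    {f : ((Cov p × ℝ) × ℝ) × ℝ → ℝ} (hf : Measurable f) {B : ℝ} (hB : ∀ t, |f t| ≤ B) {b c : ℝ}
    (hb : ∀ᵐ z ∂ν, |condMean f (gaussianReal (lin z.1 β) A.toNNReal) z| ≤ b)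
    (hc : ∀ᵐ z ∂ν, ω * |condMean f δ z| ≤ c) :
    |∫ t, f t ∂(areaLaw ν β A ω δ)| ≤ b + c := by
  rw [(integral_areaLaw ν β A hω δ hf hB).2]
  have h : ∀ᵐ z ∂ν, ‖(1 - ω) * condMean f (gaussianReal (lin z.1 β) A.toNNReal) z +
      ω * condMean f δ z‖ ≤ b + c := by
    filter_upwards [hb, hc] with z hz hz'
    refine (norm_add_le _ _).trans (add_le_add ?_ ?_)
    · rw [norm_mul, Real.norm_eq_abs, Real.norm_eq_abs, abs_of_nonneg (by linarith [hω.2])]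
      exact (mul_le_of_le_one_left (abs_nonneg _) (by linarith [hω.1])).trans hz
    · rw [norm_mul, Real.norm_eq_abs, Real.norm_eq_abs, abs_of_nonneg hω.1]
      exact hz'
  simpa using norm_integral_le_of_norm_le_const h

end AreaLaw

/-! ### What the separability index controls -/

section Contamination

/-- The probability that `|y| ≤ R` when `θ ∼ δ` and the sampling variance is `D`. -/
def contamMass (δ : Measure ℝ) (D R : ℝ) : ℝ :=
  ∫ θ, (gaussianReal θ D.toNNReal).real (Icc (-R) R) ∂δ

lemma measurable_integral_gaussianReal (D : ℝ) {f : ℝ → ℝ → ℝ}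
    (hf : Measurable (Function.uncurry f)) :
    StronglyMeasurable fun θ => ∫ y, f θ y ∂(gaussianReal θ D.toNNReal) := by
  let κ : Kernel ℝ ℝ :=
    ⟨fun θ => gaussianReal θ D.toNNReal,
      measurable_gaussianReal.comp (measurable_id.prodMk measurable_const)⟩
  have : IsMarkovKernel κ :=
    ⟨fun θ => inferInstanceAs (IsProbabilityMeasure (gaussianReal θ D.toNNReal))⟩
  exact hf.stronglyMeasurable.integral_kernel_prod_right (κ := κ)

lemma abs_integral_le_of_abs_le {X : Type*} [MeasurableSpace X] {μ : Measure X}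
    [IsProbabilityMeasure μ] {f : X → ℝ} {B : ℝ} (h : ∀ x, |f x| ≤ B) : |∫ x, f x ∂μ| ≤ B := by
  simpa using norm_integral_le_of_norm_le_const (μ := μ) (f := f) (Eventually.of_forall h)

lemma integral_margDens_mul (δ : Measure ℝ) [IsProbabilityMeasure δ] {D : ℝ} (hD : 0 < D)
    {g : ℝ → ℝ} (hg : Measurable g) {B : ℝ} (hB : ∀ y, |g y| ≤ B) :
    ∫ y, margDens δ D y * g y = ∫ θ, ∫ y, g y ∂(gaussianReal θ D.toNNReal) ∂δ := by
  have hD' : D.toNNReal ≠ 0 := (Real.toNNReal_pos.2 hD).ne'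
  simp only [integral_gaussianReal_eq_integral_smul hD', smul_eq_mul, margDens, phi,
    ← integral_mul_const]
  refine (integral_integral_swap ?_).symm
  have hm : Measurable fun z : ℝ × ℝ => gaussianPDFReal z.1 D.toNNReal z.2 :=
    measurable_gaussianPDFReal_comp measurable_fst measurable_snd
  have hint : Integrable (fun z : ℝ × ℝ => gaussianPDFReal z.1 D.toNNReal z.2)
      (δ.prod volume) := by
    rw [integrable_prod_iff hm.aestronglyMeasurable]
    refine ⟨Eventually.of_forall fun θ => integrable_gaussianPDFReal _ _, ?_⟩
    refine (integrable_const (1 : ℝ)).congr (Eventually.of_forall fun θ => ?_)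
    simp only [Real.norm_eq_abs, abs_of_nonneg (gaussianPDFReal_nonneg _ _ _)]
    rw [integral_gaussianPDFReal_eq_one _ hD']
  exact hint.mul_bdd (c := B) (hg.comp measurable_snd).aestronglyMeasurable
    (Eventually.of_forall fun z => hB z.2)

lemma phi_nonneg (y μ s : ℝ) : 0 ≤ phi y μ s := gaussianPDFReal_nonneg _ _ _

lemma measurable_phi (μ s : ℝ) : Measurable fun y => phi y μ s := measurable_gaussianPDFReal _ _

lemma phi_le {y μ s s1 : ℝ} (hs1 : 0 < s1) (hs : s1 ≤ s) :
    phi y μ s ≤ (2 * Real.pi * s1) ^ (-(1 / 2) : ℝ) := by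
  have hs0 := hs1.trans_le hs
  rw [phi_eq hs0]
  refine (mul_le_of_le_one_right (by positivity) (Real.exp_le_one_iff.2 ?_)).trans ?_
  · exact div_nonpos_of_nonpos_of_nonneg (by nlinarith [sq_nonneg (y - μ)]) (by positivity)
  · exact Real.rpow_le_rpow_of_nonpos (by positivity) (by gcongr) (by norm_num)

lemma rho_nonneg (𝒳 : Set (Cov p)) (DL DU : ℝ) (β : Cov p) (A γ : ℝ) (δ : Measure ℝ) :
    0 ≤ rho 𝒳 DL DU β A γ δ :=
  Real.iSup_nonneg fun _ => Real.iSup_nonneg fun _ => Real.iSup_nonneg fun _ =>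
    integral_nonneg fun y => mul_nonneg
      (mul_nonneg (integral_nonneg fun _ => phi_nonneg _ _ _) (Real.rpow_nonneg (phi_nonneg _ _ _) _))
      (by positivity)

/-- Only the entry `k = 0` of the maximum is needed. The uniform bound `M` matters because a real
supremum of an unbounded family is `0`, so `le_ciSup` requires boundedness. -/
lemma integral_margDens_mul_phi_le_rho {𝒳 : Set (Cov p)} {DL DU : ℝ} (hDL : 0 < DL) (β : Cov p)
    {A γ : ℝ} (hA : 0 < A) (hγ : 0 ≤ γ) (δ : Measure ℝ) [IsProbabilityMeasure δ] {x : Cov p}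
    (hx : x ∈ 𝒳) {D : ℝ} (hD : D ∈ Icc DL DU) :
    ∫ y, margDens δ D y * phi y (lin x β) (A + D) ^ γ ≤ rho 𝒳 DL DU β A γ δ := by
  set M : ℝ := ((2 * Real.pi * (A + DL)) ^ (-(1 / 2) : ℝ)) ^ γ with hM
  have hM0 : 0 ≤ M := by positivity
  have hbd : ∀ D ∈ Icc DL DU, ∀ x : Cov p,
      ∫ y, margDens δ D y * phi y (lin x β) (A + D) ^ γ * |y - lin x β| ^ ((0 : Fin 3) : ℕ) ≤ M := by
    intro D hD x
    simp only [Fin.val_zero, pow_zero, mul_one]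
    have hb : ∀ y, |phi y (lin x β) (A + D) ^ γ| ≤ M := fun y => by
      rw [abs_of_nonneg (Real.rpow_nonneg (phi_nonneg _ _ _) _)]
      exact Real.rpow_le_rpow (phi_nonneg _ _ _)
        (phi_le (by positivity) (by linarith [hD.1])) hγ
    rw [integral_margDens_mul δ (hDL.trans_le hD.1) ((measurable_phi _ _).pow_const γ) hb]
    exact (le_abs_self _).trans
      (abs_integral_le_of_abs_le fun θ => abs_integral_le_of_abs_le hb)
  have hsupx : ∀ D : Icc DL DU, BddAbove (range fun x : 𝒳 =>
      ∫ y, margDens δ D y * phi y (lin x.1 β) (A + D) ^ γ *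
        |y - lin x.1 β| ^ ((0 : Fin 3) : ℕ)) := fun D =>
    ⟨M, by rintro _ ⟨x, rfl⟩; exact hbd D D.2 x⟩
  have hsupD : BddAbove (range fun D : Icc DL DU => ⨆ x : 𝒳,
      ∫ y, margDens δ D y * phi y (lin x.1 β) (A + D) ^ γ *
        |y - lin x.1 β| ^ ((0 : Fin 3) : ℕ)) :=
    ⟨M, by rintro _ ⟨D, rfl⟩; exact Real.iSup_le (fun x => hbd D D.2 x) hM0⟩
  have h1 := le_ciSup (hsupx ⟨D, hD⟩) ⟨x, hx⟩
  have h2 := le_ciSup hsupD ⟨D, hD⟩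
  have h3 := le_ciSup (f := fun k : Fin 3 => ⨆ D : Icc DL DU, ⨆ x : 𝒳,
    ∫ y, margDens δ D y * phi y (lin x.1 β) (A + D) ^ γ * |y - lin x.1 β| ^ (k : ℕ))
    (Set.finite_range _).bddAbove 0
  simp only [Fin.val_zero, pow_zero, mul_one] at h1 h2 h3
  exact h1.trans (h2.trans h3)

/-- The separability index controls the probability that a contaminated observation stays in a
compact set. -/
lemma exists_contamMass_le_rho {𝒳 : Set (Cov p)} (h𝒳 : Bornology.IsBounded 𝒳) {DL : ℝ} (DU : ℝ)
    (hDL : 0 < DL) (β : Cov p) {A : ℝ} (hA : 0 < A) (R : ℝ) :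
    ∃ c > 0, ∀ γ ∈ Icc (0 : ℝ) 1, ∀ δ : Measure ℝ, IsProbabilityMeasure δ → ∀ x ∈ 𝒳,
      ∀ D ∈ Icc DL DU, c * contamMass δ D R ≤ rho 𝒳 DL DU β A γ δ := by
  obtain ⟨L, hL⟩ := h𝒳.exists_norm_le
  -- `q` bounds the model density from below on `|y| ≤ R`, uniformly in `x` and `D`. Capping it at
  -- `1` gives `min q 1 ≤ (min q 1) ^ γ` for `γ ≤ 1`, so the constant does not depend on `γ`.
  set q : ℝ := (2 * Real.pi * (A + |DU|)) ^ (-(1 / 2) : ℝ) *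
    Real.exp (-(|R| + |L| * ‖β‖) ^ 2 / (2 * (A + DL))) with hq
  have hq0 : 0 < q := by positivity
  refine ⟨min q 1, by positivity, fun γ hγ δ _ x hx D hD => ?_⟩
  have hD0 := hDL.trans_le hD.1
  refine le_trans ?_ (integral_margDens_mul_phi_le_rho hDL β hA hγ.1 δ hx hD)
  set M : ℝ := ((2 * Real.pi * (A + DL)) ^ (-(1 / 2) : ℝ)) ^ γ with hM
  have hb : ∀ y, |phi y (lin x β) (A + D) ^ γ| ≤ M := fun y => by
    rw [abs_of_nonneg (Real.rpow_nonneg (phi_nonneg _ _ _) _)]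
    exact Real.rpow_le_rpow (phi_nonneg _ _ _) (phi_le (by positivity) (by linarith [hD.1])) hγ.1
  have hmeas : Measurable fun y => phi y (lin x β) (A + D) ^ γ := (measurable_phi _ _).pow_const γ
  rw [integral_margDens_mul δ hD0 hmeas hb, contamMass, ← integral_const_mul]
  have hlow : ∀ y ∈ Icc (-R) R, min q 1 ≤ phi y (lin x β) (A + D) ^ γ := by
    intro y hy
    have hyR : |y| ≤ |R| := (abs_le.2 hy).trans (le_abs_self R)
    have hlin : |lin x β| ≤ |L| * ‖β‖ := (abs_lin_le x β).trans (by
      gcongr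
      exact (hL x hx).trans (le_abs_self L))
    have hphi : q ≤ phi y (lin x β) (A + D) := by
      rw [phi_eq (by positivity), hq]
      have hDU : D ≤ |DU| := hD.2.trans (le_abs_self _)
      refine mul_le_mul ?_ (Real.exp_le_exp.2 ?_) (by positivity) (by positivity)
      · exact Real.rpow_le_rpow_of_nonpos (by positivity) (by gcongr) (by norm_num)
      · rw [neg_div, neg_div, neg_le_neg_iff]
        have h1 : |y - lin x β| ≤ |R| + |L| * ‖β‖ :=
          (abs_sub _ _).trans (add_le_add hyR hlin)
        have h2 : (y - lin x β) ^ 2 ≤ (|R| + |L| * ‖β‖) ^ 2 := by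
          rw [← sq_abs (y - lin x β)]
          gcongr
        have := hD.1
        gcongr
    have hmin : 0 < min q 1 := by positivity
    calc min q 1 = (min q 1) ^ (1 : ℝ) := (Real.rpow_one _).symm
      _ ≤ (min q 1) ^ γ := Real.rpow_le_rpow_of_exponent_ge hmin (min_le_right _ _) hγ.2
      _ ≤ _ := Real.rpow_le_rpow hmin.le ((min_le_left _ _).trans hphi) hγ.1
  refine integral_mono_of_nonneg (Eventually.of_forall fun θ => by positivity) ?_
    (Eventually.of_forall fun θ => ?_)
  · refine Integrable.of_bound
      (measurable_integral_gaussianReal D (f := fun _ y => phi y (lin x β) (A + D) ^ γ)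
        (hmeas.comp measurable_snd)).aestronglyMeasurable M
      (Eventually.of_forall fun θ => abs_integral_le_of_abs_le hb)
  · beta_reduce
    rw [← integral_indicator_one measurableSet_Icc, ← integral_const_mul]
    refine integral_mono_of_nonneg (Eventually.of_forall fun y => ?_)
      (Integrable.of_bound hmeas.aestronglyMeasurable M (Eventually.of_forall hb))
      (Eventually.of_forall fun y => ?_)
    · exact mul_nonneg (by positivity) (indicator_nonneg (fun _ _ => zero_le_one) _)
    · by_cases hy : y ∈ Icc (-R) R
      · simpa [indicator_of_mem hy] using hlow y hy
      · simpa [indicator_of_notMem hy] using Real.rpow_nonneg (phi_nonneg _ _ _) _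

end Contamination

/-! ### Measurability of the interval events -/

section Measurability

lemma measurable_wGamma (γ : ℝ) (ψ : Param p) :
    Measurable fun t : ((Cov p × ℝ) × ℝ) × ℝ => wGamma γ ψ t.1.1.1 t.1.1.2 t.2 := by
  have h1 : Measurable fun t : ((Cov p × ℝ) × ℝ) × ℝ => lin t.1.1.1 ψ.1 :=
    measurable_lin (by fun_prop) _
  have h2 : Measurable fun t : ((Cov p × ℝ) × ℝ) × ℝ =>
      phi t.2 (lin t.1.1.1 ψ.1) (ψ.2 + t.1.1.2) := by
    have : Measurable fun t : ((Cov p × ℝ) × ℝ) × ℝ =>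
      (lin t.1.1.1 ψ.1, (ψ.2 + t.1.1.2).toNNReal, t.2) := by fun_prop
    exact measurable_uncurry_gaussianPDFReal.comp this
  unfold wGamma cGamma
  fun_prop

lemma measurable_thetaTilde (γ : ℝ) (ψ : Param p) :
    Measurable fun t : ((Cov p × ℝ) × ℝ) × ℝ => thetaTilde γ ψ t.1.1.1 t.1.1.2 t.2 := by
  have h1 : Measurable fun t : ((Cov p × ℝ) × ℝ) × ℝ => lin t.1.1.1 ψ.1 :=
    measurable_lin (by fun_prop) _
  have h2 := measurable_wGamma (p := p) γ ψ
  unfold thetaTilde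
  fun_prop

lemma measurable_sTildeSq (γ : ℝ) (ψ : Param p) :
    Measurable fun t : ((Cov p × ℝ) × ℝ) × ℝ => sTildeSq γ ψ t.1.1.1 t.1.1.2 t.2 := by
  have h1 : Measurable fun t : ((Cov p × ℝ) × ℝ) × ℝ => lin t.1.1.1 ψ.1 :=
    measurable_lin (by fun_prop) _
  have h2 := measurable_wGamma (p := p) γ ψ
  unfold sTildeSq
  fun_prop

/-- The event that `θ` lies in the interval with half-width enlarged by `κ`. -/
def coverSet (p : ℕ) (α γ : ℝ) (ψ : Param p) (κ : ℝ) : Set (((Cov p × ℝ) × ℝ) × ℝ) :=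
  {t | |t.1.2 - thetaTilde γ ψ t.1.1.1 t.1.1.2 t.2| <
    zUpper (α / 2) * √(sTildeSq γ ψ t.1.1.1 t.1.1.2 t.2) + κ}

lemma measurableSet_coverSet (α γ : ℝ) (ψ : Param p) (κ : ℝ) :
    MeasurableSet (coverSet p α γ ψ κ) := by
  have h1 := measurable_thetaTilde γ ψ
  have h2 := measurable_sTildeSq γ ψ
  exact measurableSet_lt
    (measurable_norm.comp ((measurable_snd.comp measurable_fst).sub h1)) (by fun_prop)

end Measurability

/-! ### Distance from the Bayes endpoints -/

section EndpointBounds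

/-- At the true parameter, the interval differs from the Bayes interval by `O(γ)`. -/
lemma exists_endpoint_bound {DL : ℝ} (DU : ℝ) (hDL : 0 < DL) {A : ℝ} (hA : 0 < A) :
    ∃ K > 0, ∀ γ ∈ Icc (0 : ℝ) 1, ∀ D ∈ Icc DL DU, ∀ u,
      |shift γ (A + D) D u - D / (A + D) * u| ≤ K * γ * (1 + |u| ^ 3) ∧
      |√(D + varShift γ (A + D) D u) - √(A * D / (A + D))| ≤ K * γ * (1 + |u| ^ 3) := by
  obtain ⟨K, hK0, hK⟩ := abs_weight_sub_one_le (s1 := A + DL) (s2 := A + DU) (by positivity)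
  -- A uniform lower bound for the posterior variance `A D / (A + D)`; it makes the square root
  -- Lipschitz there.
  set v0 : ℝ := A * DL / (A + |DU|) with hv0
  have hv0pos : 0 < v0 := by positivity
  refine ⟨2 * K + 2 * K * (1 + (A + |DU|)) / √v0, by positivity, fun γ hγ D hD u => ?_⟩
  have hγ0 := hγ.1
  have hD0 := hDL.trans_le hD.1
  have hs : 0 < A + D := by positivity
  obtain ⟨h1, h2⟩ := hK (A + D) ⟨by linarith [hD.1], by linarith [hD.2]⟩ γ hγ u
  have hw0 := weight_pos (γ := γ) (u := u) hs
  set w := weight γ (A + D) u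
  have hq0 : 0 ≤ D / (A + D) := by positivity
  have hq1 : D / (A + D) ≤ 1 := by
    rw [div_le_one hs]
    linarith
  have hu : 0 ≤ |u| := abs_nonneg u
  have hu2 : 1 + u ^ 2 ≤ 2 * (1 + |u| ^ 3) := by
    rw [← sq_abs]
    nlinarith [sq_nonneg (|u| - 1), mul_nonneg hu (sq_nonneg (|u| - 1))]
  have hu3 : (1 + u ^ 2) * |u| ≤ 2 * (1 + |u| ^ 3) := by
    rw [← sq_abs]
    nlinarith [sq_nonneg (|u| - 1), mul_nonneg hu (sq_nonneg (|u| - 1)),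
      mul_nonneg (mul_nonneg hu hu) hu]
  have hc : 0 ≤ 2 * K * (1 + (A + |DU|)) / √v0 := by positivity
  have hT : 0 ≤ γ * (1 + |u| ^ 3) := by positivity
  constructor
  · have e : shift γ (A + D) D u - D / (A + D) * u = (w - 1) * (D / (A + D)) * u := by
      simp only [shift]
      ring
    rw [e, abs_mul, abs_mul, abs_of_nonneg hq0]
    calc |w - 1| * (D / (A + D)) * |u| ≤ K * γ * (1 + u ^ 2) * 1 * |u| := by gcongr
      _ = K * γ * ((1 + u ^ 2) * |u|) := by ring
      _ ≤ K * γ * (2 * (1 + |u| ^ 3)) := by gcongr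
      _ = 2 * K * (γ * (1 + |u| ^ 3)) := by ring
      _ ≤ (2 * K + 2 * K * (1 + (A + |DU|)) / √v0) * (γ * (1 + |u| ^ 3)) := by
          gcongr
          linarith
      _ = _ := by ring
  · have hDU : D ≤ |DU| := hD.2.trans (le_abs_self _)
    have hv : v0 ≤ A * D / (A + D) := by
      rw [hv0]
      have := hD.1
      gcongr
    have hvpos := hv0pos.trans_le hv
    refine (abs_sqrt_sub_sqrt_le_div hvpos).trans ?_
    -- The Bayes variance is the case `w = 1`, `γ = 0` of the robust one. Both remaining terms, `w γ
    -- u²` and `(A + D)(w - 1)`, are of first order in `γ`.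
    have e : D + varShift γ (A + D) D u - A * D / (A + D) =
        (D / (A + D)) ^ 2 * (w * γ * u ^ 2 - (A + D) * (w - 1)) := by
      simp only [varShift]
      change D + w * _ * _ - _ = _
      field_simp
      ring
    have hb : |D + varShift γ (A + D) D u - A * D / (A + D)| ≤
        2 * K * (1 + (A + |DU|)) * (γ * (1 + |u| ^ 3)) := by
      rw [e, abs_mul, abs_of_nonneg (by positivity)]
      have h3 : |w * γ * u ^ 2 - (A + D) * (w - 1)| ≤
          K * (1 + (A + |DU|)) * γ * (1 + u ^ 2) := by
        have h4 : |w * γ * u ^ 2| ≤ K * γ * (1 + u ^ 2) := by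
          rw [abs_of_nonneg (by positivity)]
          gcongr
          linarith
        have h5 : |(A + D) * (w - 1)| ≤ (A + |DU|) * (K * γ * (1 + u ^ 2)) := by
          rw [abs_mul, abs_of_pos hs]
          gcongr
        calc _ ≤ K * γ * (1 + u ^ 2) + (A + |DU|) * (K * γ * (1 + u ^ 2)) :=
              (abs_sub _ _).trans (add_le_add h4 h5)
          _ = _ := by ring
      calc (D / (A + D)) ^ 2 * |w * γ * u ^ 2 - (A + D) * (w - 1)|
          ≤ 1 * (K * (1 + (A + |DU|)) * γ * (1 + u ^ 2)) := by
            gcongr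
            exact pow_le_one₀ hq0 hq1
        _ = K * (1 + (A + |DU|)) * γ * (1 + u ^ 2) := one_mul _
        _ ≤ K * (1 + (A + |DU|)) * γ * (2 * (1 + |u| ^ 3)) := by gcongr
        _ = _ := by ring
    calc _ ≤ 2 * K * (1 + (A + |DU|)) * (γ * (1 + |u| ^ 3)) / √v0 := by gcongr
      _ = 2 * K * (1 + (A + |DU|)) / √v0 * (γ * (1 + |u| ^ 3)) := by ring
      _ ≤ (2 * K + 2 * K * (1 + (A + |DU|)) / √v0) * (γ * (1 + |u| ^ 3)) := by
          gcongr
          linarith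
      _ = _ := by ring

end EndpointBounds

/-! ### Coverage at the true parameter -/

section Coverage

lemma abs_integral_le_integral {X : Type*} [MeasurableSpace X] {μ : Measure X} {f g : X → ℝ}
    (hg : Integrable g μ) (h : ∀ x, |f x| ≤ g x) : |∫ x, f x ∂μ| ≤ ∫ x, g x ∂μ :=
  norm_integral_le_of_norm_le (f := f) hg (Eventually.of_forall h)

/-- The centred indicator of `coverSet`. -/
def coverDev (p : ℕ) (α γ : ℝ) (ψ : Param p) (κ : ℝ) (t : ((Cov p × ℝ) × ℝ) × ℝ) : ℝ :=
  (coverSet p α γ ψ κ).indicator 1 t - (1 - α)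

lemma measurable_coverDev (α γ : ℝ) (ψ : Param p) (κ : ℝ) :
    Measurable (coverDev p α γ ψ κ) :=
  (measurable_one.indicator (measurableSet_coverSet α γ ψ κ)).sub_const _

lemma abs_coverDev_le {α : ℝ} (hα : α ∈ Ioo (0 : ℝ) 1) (γ : ℝ) (ψ : Param p) (κ : ℝ)
    (t : ((Cov p × ℝ) × ℝ) × ℝ) : |coverDev p α γ ψ κ t| ≤ 1 := by
  unfold coverDev
  by_cases ht : t ∈ coverSet p α γ ψ κ
  · rw [indicator_of_mem ht, Pi.one_apply, abs_le]
    constructor <;> linarith [hα.1, hα.2]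
  · rw [indicator_of_notMem ht, abs_le]
    constructor <;> linarith [hα.1, hα.2]

lemma integral_coverDev_comp {X : Type*} [MeasurableSpace X] (μ : Measure X)
    [IsProbabilityMeasure μ] (α γ : ℝ) (ψ : Param p) (κ : ℝ)
    {F : X → ((Cov p × ℝ) × ℝ) × ℝ} (hF : Measurable F) :
    ∫ x, coverDev p α γ ψ κ (F x) ∂μ = μ.real (F ⁻¹' coverSet p α γ ψ κ) - (1 - α) := by
  have hm : MeasurableSet (F ⁻¹' coverSet p α γ ψ κ) := hF (measurableSet_coverSet α γ ψ κ)
  have e : ∀ x, coverDev p α γ ψ κ (F x) =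
      (F ⁻¹' coverSet p α γ ψ κ).indicator 1 x - (1 - α) := fun x => rfl
  simp only [e]
  have hi : Integrable ((F ⁻¹' coverSet p α γ ψ κ).indicator (1 : X → ℝ)) μ :=
    (integrable_const (1 : ℝ)).indicator hm
  rw [integral_sub hi (integrable_const _),
    integral_indicator_one hm]
  simp

/-- Given `y`, the posterior of `θ` is normal and its Bayes interval covers exactly `1 - α`. The
robust endpoints differ by `O(γ (1 + |y - μ|³) + ε)`; the posterior density is bounded because its
variance is at least `v0`, and the cubic moment of the residual is bounded. -/
lemma exists_condMean_clean_le {DL : ℝ} (DU : ℝ) (hDL : 0 < DL) {A : ℝ} (hA : 0 < A) {α : ℝ}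
    (hα : α ∈ Ioo (0 : ℝ) 1) :
    ∃ K > 0, ∀ γ ∈ Icc (0 : ℝ) 1, ∀ (β : Cov p) (z : Cov p × ℝ), z.2 ∈ Icc DL DU →
      ∀ ε κ, |κ| ≤ ε →
      |condMean (coverDev p α γ (β, A) κ) (gaussianReal (lin z.1 β) A.toNNReal) z| ≤
        K * (γ + ε) := by
  obtain ⟨K, hK0, hK⟩ := exists_endpoint_bound DU hDL hA
  obtain ⟨M, hM0, hM⟩ := exists_gaussianReal_moment_bound (A + DU)
  set v0 : ℝ := A * DL / (A + |DU|) with hv0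
  have hv0pos : 0 < v0 := by positivity
  set q := 4 / √(2 * Real.pi * v0) with hq
  set ζ := |zUpper (α / 2)| with hζ
  refine ⟨q * ((1 + ζ) * K * M + 1), by positivity, fun γ hγ β z hz ε κ hκ => ?_⟩
  have hε : 0 ≤ ε := (abs_nonneg κ).trans hκ
  have hγ0 := hγ.1
  obtain ⟨x, D⟩ := z
  change D ∈ Icc DL DU at hz
  have hD0 := hDL.trans_le hz.1
  have hs : 0 < A + D := by positivity
  have hv : v0 ≤ A * D / (A + D) := by
    have := hz.1
    have := hz.2.trans (le_abs_self _)
    rw [hv0]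
    gcongr
  have hvpos := hv0pos.trans_le hv
  set μ := lin x β with hμ
  obtain ⟨hMi, hMb⟩ := hM μ (A + D) hs.le (by linarith [hz.2])
  rw [condMean]
  rw [integral_integral_gaussianReal_swap hA hD0 μ
    (f := fun θ y => coverDev p α γ (β, A) κ (((x, D), θ), y))
    ((measurable_coverDev _ _ _ _).comp (by fun_prop)) (fun θ y => abs_coverDev_le hα _ _ _ _)]
  have hinner : ∀ y, |∫ θ, coverDev p α γ (β, A) κ (((x, D), θ), y)
      ∂(gaussianReal (y - D / (A + D) * (y - μ)) (A * D / (A + D)).toNNReal)| ≤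
      q * ((1 + ζ) * K * γ) * (1 + |y - μ| ^ 3) + q * ε := by
    intro y
    set c := y - D / (A + D) * (y - μ) with hc
    obtain ⟨h1, h2⟩ := hK γ hγ D hz (y - μ)
    rw [integral_coverDev_comp _ α γ (β, A) κ (F := fun θ => (((x, D), θ), y)) (by fun_prop),
      ← gaussianReal_real_interval hα hvpos c]
    refine (abs_gaussianReal_interval_sub_le hvpos c (thetaTilde γ (β, A) x D y)
      (zUpper (α / 2) * √(sTildeSq γ (β, A) x D y) + κ) c
      (zUpper (α / 2) * √(A * D / (A + D)))).trans ?_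
    rw [thetaTilde_eq hγ0 hs, sTildeSq_eq hγ0 hs]
    have h3 : |y - shift γ (A + D) D (y - μ) - c| ≤ K * γ * (1 + |y - μ| ^ 3) := by
      rw [hc, show y - shift γ (A + D) D (y - μ) - (y - D / (A + D) * (y - μ)) =
        -(shift γ (A + D) D (y - μ) - D / (A + D) * (y - μ)) by ring, abs_neg]
      exact h1
    have h4 : |zUpper (α / 2) * √(D + varShift γ (A + D) D (y - μ)) + κ -
        zUpper (α / 2) * √(A * D / (A + D))| ≤ ζ * (K * γ * (1 + |y - μ| ^ 3)) + ε := by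
      rw [show zUpper (α / 2) * √(D + varShift γ (A + D) D (y - μ)) + κ -
        zUpper (α / 2) * √(A * D / (A + D)) = zUpper (α / 2) *
        (√(D + varShift γ (A + D) D (y - μ)) - √(A * D / (A + D))) + κ by ring]
      refine (abs_add_le _ _).trans (add_le_add ?_ hκ)
      rw [abs_mul]
      gcongr
    calc _ ≤ 4 * (K * γ * (1 + |y - μ| ^ 3) + (ζ * (K * γ * (1 + |y - μ| ^ 3)) + ε)) /
          √(2 * Real.pi * v0) := by
          gcongr
      _ = _ := by
          rw [hq]
          ring
  have hbi : Integrable (fun y => q * ((1 + ζ) * K * γ) * (1 + |y - μ| ^ 3) + q * ε)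
      (gaussianReal μ (A + D).toNNReal) := (hMi.const_mul _).add (integrable_const _)
  refine (abs_integral_le_integral hbi hinner).trans ?_
  rw [integral_add (hMi.const_mul _) (integrable_const _), integral_const_mul]
  simp only [integral_const, probReal_univ, smul_eq_mul, one_mul]
  have hq0 : 0 ≤ q := by positivity
  have hζ0 : 0 ≤ ζ := abs_nonneg _
  calc _ ≤ q * ((1 + ζ) * K * γ) * M + q * ε := by gcongr
    _ ≤ q * ((1 + ζ) * K * γ) * M + q * ε + (q * γ + q * ((1 + ζ) * K * M) * ε) := by
        have : 0 ≤ q * γ + q * ((1 + ζ) * K * M) * ε := by positivity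
        linarith
    _ = _ := by ring

lemma integrable_gaussianReal_real_Icc (δ : Measure ℝ) [IsProbabilityMeasure δ] (D R : ℝ) :
    Integrable (fun θ => (gaussianReal θ D.toNNReal).real (Icc (-R) R)) δ := by
  refine Integrable.of_bound (C := 1) ?_ (Eventually.of_forall fun θ => ?_)
  · have := measurable_integral_gaussianReal D
      (f := fun _ y => (Icc (-R) R).indicator (1 : ℝ → ℝ) y)
      ((measurable_one.indicator measurableSet_Icc).comp measurable_snd)
    simp only [integral_indicator_one measurableSet_Icc] at this
    exact this.aestronglyMeasurable
  · rw [Real.norm_eq_abs, abs_of_nonneg measureReal_nonneg]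
    exact measureReal_le_one

/-- Here the conditioning is on `θ`. Outside `[-R, R]` the interval is within `2 ε` of `y ± z √D`,
whose coverage under `y ∼ N(θ, D)` is exactly `1 - α` for every `θ`. Thus `δ` matters only through
`contamMass`, and the coefficient of `ε` involves neither `R` nor `γlo`. -/
lemma exists_condMean_contam_le {𝒳 : Set (Cov p)} (h𝒳 : Bornology.IsBounded 𝒳) {DL DU : ℝ}
    (hDL : 0 < DL) (hDU : DL ≤ DU) (β : Cov p) {A : ℝ} (hA : 0 < A) {α : ℝ}
    (hα : α ∈ Ioo (0 : ℝ) 1)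
    {γlo γhi : ℝ} (hγlo : 0 < γlo) {ε : ℝ} (hε : 0 < ε) :
    ∃ R, ∀ γ ∈ Icc γlo γhi, ∀ δ : Measure ℝ, IsProbabilityMeasure δ → ∀ z : Cov p × ℝ,
      z.1 ∈ 𝒳 → z.2 ∈ Icc DL DU → ∀ κ, |κ| ≤ ε →
      |condMean (coverDev p α γ (β, A) κ) δ z| ≤
        contamMass δ z.2 R + 8 / √(2 * Real.pi * DL) * ε := by
  obtain ⟨L, hL⟩ := h𝒳.exists_norm_le
  have hs2 : 0 < A + DU := by linarith
  set ζ := |zUpper (α / 2)| with hζ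
  -- Chosen so that the centre error `η` plus the half-width error `ζ η / √DL` equals `ε`; the other
  -- `ε` in `2 ε` pays for `κ`.
  set η := ε / (1 + ζ / √DL) with hη
  have hη0 : 0 < η := by positivity
  have hηε : η + ζ * (η / √DL) = ε := by
    have h : 1 + ζ / √DL ≠ 0 := by positivity
    calc η + ζ * (η / √DL) = η * (1 + ζ / √DL) := by ring
      _ = ε := div_mul_cancel₀ _ h
  obtain ⟨R1, hR1⟩ := (unif_shift (DU := DU) (γhi := γhi) hDL hs2 hγlo).2 η hη0
  obtain ⟨R2, hR2⟩ := (unif_varShift (DU := DU) (γhi := γhi) hDL hs2 hγlo).2 η hη0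
  refine ⟨max R1 R2 + |L| * ‖β‖, fun γ hγ δ _ z hzx hzD κ hκ => ?_⟩
  obtain ⟨x, D⟩ := z
  change x ∈ 𝒳 at hzx
  change D ∈ Icc DL DU at hzD
  set R := max R1 R2 + |L| * ‖β‖ with hR
  have hD0 := hDL.trans_le hzD.1
  have hs : 0 < A + D := by positivity
  have hγ0 : 0 ≤ γ := hγlo.le.trans hγ.1
  have hsmem : A + D ∈ Icc DL (A + DU) := ⟨by linarith [hzD.1], by linarith [hzD.2]⟩
  set μ := lin x β with hμ
  have hμL : |μ| ≤ |L| * ‖β‖ := (abs_lin_le x β).trans (by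
    gcongr
    exact (hL x hzx).trans (le_abs_self L))
  have hband : ∀ y, y ∉ Icc (-R) R →
      |thetaTilde γ (β, A) x D y - y| +
        |zUpper (α / 2) * √(sTildeSq γ (β, A) x D y) + κ - zUpper (α / 2) * √D| ≤ 2 * ε := by
    intro y hy
    have hyR : R < |y| := by
      by_contra! h
      exact hy (abs_le.1 h)
    have hu : max R1 R2 < |y - μ| := by
      have := abs_sub_abs_le_abs_sub y μ
      linarith
    have h1 := hR1 (y - μ) (A + D) hsmem γ hγ D hzD ((le_max_left _ _).trans_lt hu)
    have h2 := hR2 (y - μ) (A + D) hsmem γ hγ D hzD ((le_max_right _ _).trans_lt hu)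
    rw [thetaTilde_eq hγ0 hs, sTildeSq_eq hγ0 hs]
    have h3 : |y - shift γ (A + D) D (y - μ) - y| ≤ η := by
      rw [show y - shift γ (A + D) D (y - μ) - y = -shift γ (A + D) D (y - μ) by ring, abs_neg]
      exact h1
    have h4 : |√(D + varShift γ (A + D) D (y - μ)) - √D| ≤ η / √DL := by
      refine (abs_sqrt_sub_sqrt_le_div hD0).trans ?_
      rw [add_sub_cancel_left]
      have := hzD.1
      gcongr
    have h5 : |zUpper (α / 2) * √(D + varShift γ (A + D) D (y - μ)) + κ - zUpper (α / 2) * √D| ≤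
        ζ * (η / √DL) + ε := by
      rw [show zUpper (α / 2) * √(D + varShift γ (A + D) D (y - μ)) + κ - zUpper (α / 2) * √D =
        zUpper (α / 2) * (√(D + varShift γ (A + D) D (y - μ)) - √D) + κ by ring]
      refine (abs_add_le _ _).trans (add_le_add ?_ hκ)
      rw [abs_mul]
      gcongr
    calc _ ≤ η + (ζ * (η / √DL) + ε) := add_le_add h3 h5
      _ = 2 * ε := by linarith
  have hinner : ∀ θ, |∫ y, coverDev p α γ (β, A) κ (((x, D), θ), y)
      ∂(gaussianReal θ D.toNNReal)| ≤
      (gaussianReal θ D.toNNReal).real (Icc (-R) R) + 8 / √(2 * Real.pi * DL) * ε := by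
    intro θ
    rw [integral_coverDev_comp _ α γ (β, A) κ (F := fun y => (((x, D), θ), y)) (by fun_prop),
      ← gaussianReal_real_interval hα hD0 θ]
    refine (abs_measureReal_sub_le
      (B := Icc (-R) R ∪ {t | |(|t - θ| - zUpper (α / 2) * √D)| ≤ 2 * ε}) fun y hy => ?_).trans ?_
    · rw [mem_union, not_or] at hy
      have := mem_interval_iff_of_notMem_band (t := θ) (hband y hy.1)
        (by rw [abs_sub_comm θ y]; exact hy.2)
      rw [abs_sub_comm θ y] at this
      exact this
    · refine (measureReal_union_le _ _).trans (add_le_add le_rfl ?_)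
      refine (gaussianReal_real_band_le hD0 θ θ _ (2 * ε) (by positivity)).trans ?_
      have := hzD.1
      calc 4 * (2 * ε) / √(2 * Real.pi * D) ≤ 4 * (2 * ε) / √(2 * Real.pi * DL) := by gcongr
        _ = _ := by ring
  have hmi := integrable_gaussianReal_real_Icc δ D R
  rw [condMean]
  refine (abs_integral_le_integral
    (hmi.add (integrable_const (8 / √(2 * Real.pi * DL) * ε))) hinner).trans ?_
  simp only [Pi.add_apply]
  rw [integral_add hmi (integrable_const _)]
  simp [contamMass]

/-- Coverage of the interval at the true parameter, with half-width perturbed by `κ`. -/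
lemma exists_coverage_bound {DL DU : ℝ} (hDL : 0 < DL) (hDU : DL ≤ DU) (β : Cov p) {A : ℝ}
    (hA : 0 < A) {α : ℝ} (hα : α ∈ Ioo (0 : ℝ) 1) :
    ∃ K > 0, ∀ 𝒳 : Set (Cov p), Bornology.IsBounded 𝒳 →
      ∀ ν : Measure (Cov p × ℝ), IsProbabilityMeasure ν →
      (∀ᵐ z ∂ν, z.1 ∈ 𝒳 ∧ z.2 ∈ Icc DL DU) →
      ∀ γlo γhi : ℝ, 0 < γlo → γhi < 1 → ∀ ε > 0, ∃ c > 0, ∀ γ ∈ Icc γlo γhi,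
      ∀ ω ∈ Icc (0 : ℝ) 1, ∀ δ : Measure ℝ, IsProbabilityMeasure δ → ∀ κ, |κ| ≤ ε →
      |(areaLaw ν β A ω δ).real (coverSet p α γ (β, A) κ) - (1 - α)| ≤
        K * (γ + ε) + ω * rho 𝒳 DL DU β A γ δ / c := by
  obtain ⟨K, hK0, hK⟩ := exists_condMean_clean_le (p := p) DU hDL hA hα
  -- The leading constant is fixed before `𝒳`, `ν`, `γlo`, `γhi` and `ε`; dependence on `𝒳`, `γlo`,
  -- `γhi` and `ε` is confined to `c`.
  refine ⟨K + 8 / √(2 * Real.pi * DL), by positivity, fun 𝒳 h𝒳 ν _ hν γlo γhi hlo hhi ε hε => ?_⟩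
  obtain ⟨R, hR⟩ := exists_condMean_contam_le h𝒳 hDL hDU β hA hα (γhi := γhi) hlo hε
  obtain ⟨c, hc0, hc⟩ := exists_contamMass_le_rho h𝒳 DU hDL β hA R
  refine ⟨c, hc0, fun γ hγ ω hω δ _ κ hκ => ?_⟩
  have hγ1 : γ ∈ Icc (0 : ℝ) 1 := ⟨hlo.le.trans hγ.1, hγ.2.trans hhi.le⟩
  have hprob := isProbabilityMeasure_areaLaw ν β A hω δ
  have h1 := integral_coverDev_comp (areaLaw ν β A ω δ) α γ (β, A) κ (F := id) measurable_id
  simp only [id_eq, preimage_id_eq] at h1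
  rw [← h1]
  refine (abs_integral_areaLaw_le (b := K * (γ + ε))
    (c := ω * rho 𝒳 DL DU β A γ δ / c + 8 / √(2 * Real.pi * DL) * ε) ν β A hω δ
    (measurable_coverDev _ _ _ _) (fun t => abs_coverDev_le hα _ _ _ _) ?_ ?_).trans ?_
  · filter_upwards [hν] with z hz
    exact hK γ hγ1 β z hz.2 ε κ hκ
  · filter_upwards [hν] with z hz
    have h2 := hR γ hγ δ ‹_› z hz.1 hz.2 κ hκ
    have h3 := hc γ hγ1 δ ‹_› z.1 hz.1 z.2 hz.2
    have h4 : contamMass δ z.2 R ≤ rho 𝒳 DL DU β A γ δ / c := by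
      rw [le_div_iff₀ hc0]
      linarith
    have h5 : 0 ≤ 8 / √(2 * Real.pi * DL) * ε := by positivity
    calc ω * |condMean (coverDev p α γ (β, A) κ) δ z|
        ≤ ω * (rho 𝒳 DL DU β A γ δ / c + 8 / √(2 * Real.pi * DL) * ε) :=
          mul_le_mul_of_nonneg_left (by linarith) hω.1
      _ = ω * rho 𝒳 DL DU β A γ δ / c + ω * (8 / √(2 * Real.pi * DL) * ε) := by ring
      _ ≤ _ := by
          gcongr ?_ + ?_
          · exact le_rfl
          · exact mul_le_of_le_one_left h5 hω.2
  · have h5 : 0 ≤ 8 / √(2 * Real.pi * DL) * γ := by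
      have := hγ1.1
      positivity
    linarith

end Coverage

/-! ### Identifiability and separation of the population objective -/

section Gap

variable {DL DU : ℝ} {As : ℝ} {βs : Cov p}

/-- The loss in the conditional population objective of using `ψ` instead of the true parameter. -/
def popGap (βs : Cov p) (As γ : ℝ) (ψ : Param p) (z : Cov p × ℝ) : ℝ :=
  popWeight γ (As + z.2) (As + z.2) 0 -
    popWeight γ (As + z.2) (ψ.2 + z.2) (lin z.1 βs - lin z.1 ψ.1)

lemma measurable_popGap (γ : ℝ) (ψ : Param p) : Measurable (popGap βs As γ ψ) := by
  have h1 : Measurable fun z : Cov p × ℝ => lin z.1 βs := measurable_lin (by fun_prop) _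
  have h2 : Measurable fun z : Cov p × ℝ => lin z.1 ψ.1 := measurable_lin (by fun_prop) _
  unfold popGap popWeight
  fun_prop

lemma popGap_nonneg (hDL : 0 < DL) (hAs : 0 < As) {γ : ℝ} (hγ : 0 < γ) {ψ : Param p}
    (hψ : 0 < ψ.2) {z : Cov p × ℝ} (hz : z.2 ∈ Icc DL DU) : 0 ≤ popGap βs As γ ψ z := by
  have hD := hDL.trans_le hz.1
  exact sub_nonneg.2 (popWeight_le hγ (by positivity) (by positivity))

lemma popWeight_le_weight {γ s s' d : ℝ} (hγ : 0 < γ) (hs : 0 < s) (hs' : 0 < s') :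
    popWeight γ s' s d ≤ weight γ s 0 := by
  have h1 : √(s / (s + γ * s')) ≤ 1 := by
    have : 0 < γ * s' := by positivity
    exact Real.sqrt_le_one.2 ((div_le_one (by positivity)).2 (by linarith))
  have h2 : Real.exp (-(γ * d ^ 2) / (2 * (s + γ * s'))) ≤ 1 := by
    rw [Real.exp_le_one_iff]
    exact div_nonpos_of_nonpos_of_nonneg (neg_nonpos.2 (by positivity)) (by positivity)
  have h0 : 0 < (2 * Real.pi * s) ^ (-(γ / (2 * (1 + γ)))) := by positivity
  have e : weight γ s 0 = (2 * Real.pi * s) ^ (-(γ / (2 * (1 + γ)))) * 1 * 1 := by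
    simp [weight]
  rw [popWeight, e]
  gcongr

lemma abs_popGap_le (hDL : 0 < DL) (hAs : 0 < As) {s2 W : ℝ} (hAs2 : As + DU ≤ s2)
    (hW : ∀ s ∈ Icc DL s2, ∀ γ ∈ Icc (0 : ℝ) 1, ∀ u, weight γ s u ≤ W)
    {γ : ℝ} (hγ : γ ∈ Ioo (0 : ℝ) 1) {ψ : Param p} (hψ : 0 < ψ.2) {z : Cov p × ℝ}
    (hz : z.2 ∈ Icc DL DU) : |popGap βs As γ ψ z| ≤ W := by
  have hD := hDL.trans_le hz.1
  have h1 : 0 < As + z.2 := by positivity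
  have h2 : 0 < ψ.2 + z.2 := by positivity
  rw [abs_of_nonneg (popGap_nonneg hDL hAs hγ.1 hψ hz), popGap]
  have h3 := popWeight_pos (d := lin z.1 βs - lin z.1 ψ.1) hγ.1 h2 h1
  have h4 := popWeight_le_weight (d := 0) hγ.1 h1 h1
  have h5 := hW (As + z.2) ⟨by linarith [hz.1], by linarith [hz.2]⟩ γ ⟨hγ.1.le, hγ.2.le⟩ 0
  linarith

/-- If `xᵀ b = 0` almost surely then `E[x xᵀ] b = 0`, contradicting positive definiteness unless `b
= 0`. Boundedness of `𝒳` makes the matrix entries integrable. -/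
lemma eq_zero_of_lin_ae_eq_zero {𝒳 : Set (Cov p)} (h𝒳 : Bornology.IsBounded 𝒳)
    {ν : Measure (Cov p × ℝ)} [IsProbabilityMeasure ν] (hν : ∀ᵐ z ∂ν, z.1 ∈ 𝒳)
    (hM : (secondMoment ν).PosDef) {b : Cov p} (hb : ∀ᵐ z ∂ν, lin z.1 b = 0) : b = 0 := by
  obtain ⟨L, hL⟩ := h𝒳.exists_norm_le
  have hint : ∀ j k, Integrable (fun z : Cov p × ℝ => z.1 j * z.1 k) ν := by
    intro j k
    refine Integrable.of_bound (by fun_prop) (L * L) ?_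
    filter_upwards [hν] with z hz
    have h1 := hL _ hz
    rw [norm_mul]
    have h0 : 0 ≤ L := (norm_nonneg _).trans h1
    have hj := (PiLp.norm_apply_le z.1 j).trans h1
    have hk := (PiLp.norm_apply_le z.1 k).trans h1
    gcongr
  have hmul : Matrix.mulVec (secondMoment ν) (fun j => b j) = 0 := by
    funext j
    simp only [Matrix.mulVec, dotProduct, secondMoment, Matrix.of_apply, Pi.zero_apply]
    simp only [← integral_mul_const]
    rw [← integral_finsetSum _ fun k _ => (hint j k).mul_const _]
    refine integral_eq_zero_of_ae ?_
    filter_upwards [hb] with z hz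
    simp only [mul_assoc, ← Finset.mul_sum, Pi.zero_apply]
    rw [lin] at hz
    rw [hz, mul_zero]
  by_contra hne
  have hne' : (fun j => b j) ≠ (0 : Fin p → ℝ) := fun h => hne (by
    ext j
    exact congrFun h j)
  have := hM.dotProduct_mulVec_pos hne'
  rw [hmul, dotProduct_zero] at this
  exact lt_irrefl _ this

lemma integral_popGap_pos (hDL : 0 < DL) (hAs : 0 < As) {𝒳 : Set (Cov p)}
    (h𝒳 : Bornology.IsBounded 𝒳)
    {ν : Measure (Cov p × ℝ)} [IsProbabilityMeasure ν]
    (hν : ∀ᵐ z ∂ν, z.1 ∈ 𝒳 ∧ z.2 ∈ Icc DL DU) (hM : (secondMoment ν).PosDef)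
    {γ : ℝ} (hγ : 0 < γ) {ψ : Param p} (hψ : 0 < ψ.2) (hne : ψ ≠ (βs, As))
    (hi : Integrable (popGap βs As γ ψ) ν) :
    0 < ∫ z, popGap βs As γ ψ z ∂ν := by
  have hnn : 0 ≤ᵐ[ν] popGap βs As γ ψ := by
    filter_upwards [hν] with z hz
    exact popGap_nonneg hDL hAs hγ hψ hz.2
  refine (integral_nonneg_of_ae hnn).lt_of_ne fun h0 => hne ?_
  have hz0 := (integral_eq_zero_iff_of_nonneg_ae hnn hi).1 h0.symm
  have hae : ∀ᵐ z ∂ν, ψ.2 = As ∧ lin z.1 (βs - ψ.1) = 0 := by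
    filter_upwards [hν, hz0] with z hz h
    have hD := hDL.trans_le hz.2.1
    have h1 := (popWeight_eq_iff hγ (show 0 < ψ.2 + z.2 by positivity)
      (show 0 < As + z.2 by positivity)).1 (sub_eq_zero.1 h).symm
    refine ⟨by linarith [h1.1], ?_⟩
    rw [lin_eq_inner, inner_sub_left, ← lin_eq_inner, ← lin_eq_inner]
    exact h1.2
  have hb := eq_zero_of_lin_ae_eq_zero h𝒳 (hν.mono fun z h => h.1) hM (hae.mono fun z h => h.2)
  obtain ⟨z, hz⟩ := hae.exists
  exact Prod.ext (sub_eq_zero.1 hb).symm hz.1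

/-- The mean gap is continuous in `(γ, ψ)` by dominated convergence and positive off the true
parameter, so it attains a positive minimum on `[γlo, γhi] × K`. One `g` serves every `γ`. -/
lemma exists_popGap_lower_bound (hDL : 0 < DL) (hAs : 0 < As) {𝒳 : Set (Cov p)}
    (h𝒳 : Bornology.IsBounded 𝒳)
    {ν : Measure (Cov p × ℝ)} [IsProbabilityMeasure ν]
    (hν : ∀ᵐ z ∂ν, z.1 ∈ 𝒳 ∧ z.2 ∈ Icc DL DU) (hM : (secondMoment ν).PosDef)
    {K : Set (Param p)} (hK : IsCompact K) (hpos : ∀ ψ ∈ K, 0 < ψ.2) (hne : (βs, As) ∉ K)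
    {γlo γhi : ℝ} (hlo : 0 < γlo) (hhi : γhi < 1) :
    ∃ g > 0, ∀ γ ∈ Icc γlo γhi, ∀ ψ ∈ K,
      Integrable (popGap βs As γ ψ) ν ∧ g ≤ ∫ z, popGap βs As γ ψ z ∂ν := by
  obtain ⟨W, hW0, hW'⟩ := abs_weight_sub_one_le (s1 := DL) (s2 := As + DU) hDL
  have hW : ∀ s ∈ Icc DL (As + DU), ∀ γ ∈ Icc (0 : ℝ) 1, ∀ u, weight γ s u ≤ W :=
    fun s hs γ hγ u => (hW' s hs γ hγ u).2
  have hγ01 : ∀ γ ∈ Icc γlo γhi, γ ∈ Ioo (0 : ℝ) 1 := fun γ hγ =>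
    ⟨hlo.trans_le hγ.1, hγ.2.trans_lt hhi⟩
  have hbd : ∀ q ∈ Icc γlo γhi ×ˢ K, ∀ᵐ z ∂ν, ‖popGap βs As q.1 q.2 z‖ ≤ W := by
    intro q hq
    filter_upwards [hν] with z hz
    exact abs_popGap_le hDL hAs le_rfl hW (hγ01 _ hq.1) (hpos _ hq.2) hz.2
  have hint : ∀ γ ∈ Icc γlo γhi, ∀ ψ ∈ K, Integrable (popGap βs As γ ψ) ν := fun γ hγ ψ hψ =>
    Integrable.of_bound (measurable_popGap γ ψ).aestronglyMeasurable W (hbd (γ, ψ) ⟨hγ, hψ⟩)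
  have hcont : ContinuousOn (fun q : ℝ × Param p => ∫ z, popGap βs As q.1 q.2 z ∂ν)
      (Icc γlo γhi ×ˢ K) := by
    refine continuousOn_of_dominated (bound := fun _ => W)
      (fun q _ => (measurable_popGap q.1 q.2).aestronglyMeasurable) hbd (integrable_const W) ?_
    filter_upwards [hν] with z hz
    have hD := hDL.trans_le hz.2.1
    have hpw : ∀ f g : ℝ × Param p → ℝ, ContinuousOn f (Icc γlo γhi ×ˢ K) →
        ContinuousOn g (Icc γlo γhi ×ˢ K) → (∀ q ∈ Icc γlo γhi ×ˢ K, 0 < f q) →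
        ContinuousOn (fun q => popWeight q.1 (As + z.2) (f q) (g q)) (Icc γlo γhi ×ˢ K) := by
      intro f g hf hg hfpos
      have hq1 : ∀ q ∈ Icc γlo γhi ×ˢ K, 0 < q.1 := fun q hq => (hγ01 _ hq.1).1
      have hden : ∀ q ∈ Icc γlo γhi ×ˢ K, 0 < f q + q.1 * (As + z.2) := fun q hq => by
        have := hfpos q hq
        have := hq1 q hq
        positivity
      unfold popWeight
      refine ContinuousOn.mul (ContinuousOn.mul (ContinuousOn.rpow (by fun_prop) ?_ fun q hq =>
        Or.inl ?_) ?_) ?_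
      · refine ContinuousOn.neg (ContinuousOn.div (by fun_prop) (by fun_prop) fun q hq => ?_)
        have := hq1 q hq
        positivity
      · have := hfpos q hq
        positivity
      · exact (ContinuousOn.div hf (by fun_prop) fun q hq => (hden q hq).ne').sqrt
      · refine Real.continuous_exp.comp_continuousOn
          (ContinuousOn.div (by fun_prop) (by fun_prop) fun q hq => ?_)
        have := hden q hq
        positivity
    unfold popGap
    refine (hpw _ _ continuousOn_const continuousOn_const fun q hq => by positivity).sub
      (hpw _ _ (by fun_prop) ?_ fun q hq => ?_)
    · unfold lin
      fun_prop
    · have := hpos _ hq.2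
      positivity
  rcases (Icc γlo γhi ×ˢ K).eq_empty_or_nonempty with he | hn
  · refine ⟨1, one_pos, fun γ hγ ψ hψ => ?_⟩
    have : (γ, ψ) ∈ Icc γlo γhi ×ˢ K := ⟨hγ, hψ⟩
    rw [he] at this
    exact this.elim
  · obtain ⟨q, hq, hmin⟩ := (isCompact_Icc.prod hK).exists_isMinOn hn hcont
    refine ⟨∫ z, popGap βs As q.1 q.2 z ∂ν, ?_, fun γ hγ ψ hψ =>
      ⟨hint γ hγ ψ hψ, hmin (a := (γ, ψ)) ⟨hγ, hψ⟩⟩⟩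
    exact integral_popGap_pos hDL hAs h𝒳 hν hM (hγ01 _ hq.1).1 (hpos _ hq.2)
      (fun h => hne (h ▸ hq.2)) (hint _ hq.1 _ hq.2)

end Gap

/-! ### The mean contrast under contamination -/

section Contrast

/-- The difference of weights at two parameters, set to zero off the admissible variances. -/
def contrast (DL DU γ : ℝ) (ψ ψ' : Param p) (t : ((Cov p × ℝ) × ℝ) × ℝ) : ℝ :=
  {t : ((Cov p × ℝ) × ℝ) × ℝ | t.1.1.2 ∈ Icc DL DU}.indicator
    (fun t => wGamma γ ψ t.1.1.1 t.1.1.2 t.2 - wGamma γ ψ' t.1.1.1 t.1.1.2 t.2) t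

lemma measurable_contrast (DL DU γ : ℝ) (ψ ψ' : Param p) :
    Measurable (contrast DL DU γ ψ ψ') := by
  have hset : MeasurableSet {t : ((Cov p × ℝ) × ℝ) × ℝ | t.1.1.2 ∈ Icc DL DU} :=
    (measurable_snd.comp (measurable_fst.comp measurable_fst)) measurableSet_Icc
  exact ((measurable_wGamma γ ψ).sub (measurable_wGamma γ ψ')).indicator hset

lemma contrast_eq {DL DU γ : ℝ} {ψ ψ' : Param p} {x : Cov p} {D θ y : ℝ} (hD : D ∈ Icc DL DU) :
    contrast DL DU γ ψ ψ' (((x, D), θ), y) = wGamma γ ψ x D y - wGamma γ ψ' x D y :=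
  indicator_of_mem (s := {t : ((Cov p × ℝ) × ℝ) × ℝ | t.1.1.2 ∈ Icc DL DU}) hD _

variable {DL DU s2 W : ℝ}

lemma abs_contrast_le (hDL : 0 < DL) (hW0 : 0 < W)
    (hW : ∀ s ∈ Icc DL s2, ∀ γ ∈ Icc (0 : ℝ) 1, ∀ u, weight γ s u ≤ W)
    {γ : ℝ} (hγ : γ ∈ Icc (0 : ℝ) 1) {ψ ψ' : Param p} (hψ : 0 < ψ.2) (hψ' : 0 < ψ'.2)
    (hψs : ψ.2 + DU ≤ s2) (hψs' : ψ'.2 + DU ≤ s2) (t : ((Cov p × ℝ) × ℝ) × ℝ) :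
    |contrast DL DU γ ψ ψ' t| ≤ W := by
  obtain ⟨⟨⟨x, D⟩, θ⟩, y⟩ := t
  by_cases hD : D ∈ Icc DL DU
  · have hD0 := hDL.trans_le hD.1
    have h1 : 0 < ψ.2 + D := by positivity
    have h2 : 0 < ψ'.2 + D := by positivity
    rw [contrast_eq hD, wGamma_eq hγ.1 h1, wGamma_eq hγ.1 h2]
    exact abs_sub_le_of_nonneg_of_le (weight_pos h1).le
      (hW _ ⟨by linarith [hD.1], by linarith [hD.2]⟩ γ hγ _) (weight_pos h2).le
      (hW _ ⟨by linarith [hD.1], by linarith [hD.2]⟩ γ hγ _)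
  · have : contrast DL DU γ ψ ψ' (((x, D), θ), y) = 0 :=
      indicator_of_notMem (s := {t : ((Cov p × ℝ) × ℝ) × ℝ | t.1.1.2 ∈ Icc DL DU}) hD _
    rw [this, abs_zero]
    exact hW0.le

/-- Integrating out `θ` leaves `y ∼ N(xᵀβs, As + D)`, and the two mean weights are the two terms of
`popGap`. -/
lemma condMean_contrast_clean (hDL : 0 < DL) {γ : ℝ} (hγ : 0 < γ) {ψ : Param p} (hψ : 0 < ψ.2)
    {βs : Cov p} {As : ℝ} (hAs : 0 < As) {W : ℝ}
    (hbd : ∀ t, |contrast DL DU γ ψ (βs, As) t| ≤ W) {z : Cov p × ℝ} (hz : z.2 ∈ Icc DL DU) :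
    condMean (contrast DL DU γ ψ (βs, As)) (gaussianReal (lin z.1 βs) As.toNNReal) z =
      -popGap βs As γ ψ z := by
  obtain ⟨x, D⟩ := z
  change D ∈ Icc DL DU at hz
  have hD0 := hDL.trans_le hz.1
  have h1 : 0 < ψ.2 + D := by positivity
  have h2 : 0 < As + D := by positivity
  rw [condMean, integral_integral_gaussianReal_swap hAs hD0 (lin x βs)
    (f := fun θ y => contrast DL DU γ ψ (βs, As) (((x, D), θ), y))
    ((measurable_contrast _ _ _ _ _).comp (by fun_prop)) (fun θ y => hbd _)]
  simp only [contrast_eq hz, integral_const, probReal_univ, one_smul]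
  have hint : ∀ (s : ℝ), 0 < s → ∀ μ : ℝ, Integrable (fun y => weight γ s (y - μ))
      (gaussianReal (lin x βs) (As + D).toNNReal) := by
    intro s hs μ
    refine Integrable.of_bound (C := weight γ s 0) ?_ (Eventually.of_forall fun y => ?_)
    · unfold weight
      fun_prop
    · rw [Real.norm_eq_abs, abs_of_pos (weight_pos hs), weight, weight]
      gcongr ?_ * Real.exp ?_
      have : 0 ≤ γ * (y - μ) ^ 2 := by positivity
      simpa using div_nonpos_of_nonpos_of_nonneg (neg_nonpos.2 this) (by positivity)
  have e1 : ∀ y, wGamma γ ψ x D y = weight γ (ψ.2 + D) (y - lin x ψ.1) := fun y =>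
    wGamma_eq hγ.le h1
  have e2 : ∀ y, wGamma γ (βs, As) x D y = weight γ (As + D) (y - lin x βs) := fun y =>
    wGamma_eq hγ.le h2
  simp only [e1, e2]
  rw [integral_sub (hint _ h1 _) (hint _ h2 _), integral_weight_gaussianReal hγ h1 h2,
    integral_weight_gaussianReal hγ h2 h2, popGap, sub_self]
  ring

/-- The contaminated part of the mean contrast is small, since far observations get no weight. -/
lemma exists_condMean_contrast_contam_le {𝒳 : Set (Cov p)} (h𝒳 : Bornology.IsBounded 𝒳)
    (hDL : 0 < DL) (hs2 : 0 < s2) (hW0 : 0 < W)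
    (hW : ∀ s ∈ Icc DL s2, ∀ γ ∈ Icc (0 : ℝ) 1, ∀ u, weight γ s u ≤ W) (Lβ : ℝ)
    {γlo γhi : ℝ} (hlo : 0 < γlo) (hhi : γhi < 1) {ε : ℝ} (hε : 0 < ε) :
    ∃ R, ∀ γ ∈ Icc γlo γhi, ∀ δ : Measure ℝ, IsProbabilityMeasure δ → ∀ ψ ψ' : Param p,
      0 < ψ.2 → 0 < ψ'.2 → ψ.2 + DU ≤ s2 → ψ'.2 + DU ≤ s2 → ‖ψ.1‖ ≤ Lβ → ‖ψ'.1‖ ≤ Lβ →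
      ∀ z : Cov p × ℝ, z.1 ∈ 𝒳 → z.2 ∈ Icc DL DU →
      |condMean (contrast DL DU γ ψ ψ') δ z| ≤ W * contamMass δ z.2 R + ε := by
  obtain ⟨L, hL⟩ := h𝒳.exists_norm_le
  obtain ⟨R0, hR0⟩ := (unif_weight (γhi := γhi) hDL hs2 hlo).2 ε hε
  refine ⟨R0 + |L| * |Lβ|, ?_⟩
  intro γ hγ δ _ ψ ψ' hψ hψ' hψs hψs' hψL hψL' z hzx hzD
  obtain ⟨x, D⟩ := z
  change x ∈ 𝒳 at hzx
  change D ∈ Icc DL DU at hzD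
  set R := R0 + |L| * |Lβ| with hR
  have hγ1 : γ ∈ Icc (0 : ℝ) 1 := ⟨hlo.le.trans hγ.1, hγ.2.trans hhi.le⟩
  have hD0 := hDL.trans_le hzD.1
  have hbd := abs_contrast_le hDL hW0 hW hγ1 hψ hψ' hψs hψs'
  have hfar : ∀ ψ : Param p, 0 < ψ.2 → ψ.2 + DU ≤ s2 → ‖ψ.1‖ ≤ Lβ → ∀ y, R < |y| →
      0 ≤ wGamma γ ψ x D y ∧ wGamma γ ψ x D y ≤ ε := by
    intro ψ hψ hψs hψL y hy
    have h1 : 0 < ψ.2 + D := by positivity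
    rw [wGamma_eq hγ1.1 h1]
    refine ⟨(weight_pos h1).le, (le_abs_self _).trans (hR0 _ _ ⟨by linarith [hzD.1],
      by linarith [hzD.2]⟩ γ hγ ?_)⟩
    have h2 : |lin x ψ.1| ≤ |L| * |Lβ| := (abs_lin_le x ψ.1).trans (by
      gcongr
      · exact (hL x hzx).trans (le_abs_self L)
      · exact hψL.trans (le_abs_self Lβ))
    have := abs_sub_abs_le_abs_sub y (lin x ψ.1)
    linarith
  have hpt : ∀ θ y, |contrast DL DU γ ψ ψ' (((x, D), θ), y)| ≤
      W * (Icc (-R) R).indicator (1 : ℝ → ℝ) y + ε := by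
    intro θ y
    by_cases hy : y ∈ Icc (-R) R
    · rw [indicator_of_mem hy, Pi.one_apply, mul_one]
      linarith [hbd (((x, D), θ), y)]
    · have hyR : R < |y| := by
        by_contra! h
        exact hy (abs_le.1 h)
      rw [indicator_of_notMem hy, mul_zero, zero_add, contrast_eq hzD]
      obtain ⟨a1, a2⟩ := hfar ψ hψ hψs hψL y hyR
      obtain ⟨b1, b2⟩ := hfar ψ' hψ' hψs' hψL' y hyR
      exact abs_sub_le_of_nonneg_of_le a1 a2 b1 b2
  have hinner : ∀ θ, |∫ y, contrast DL DU γ ψ ψ' (((x, D), θ), y) ∂(gaussianReal θ D.toNNReal)| ≤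
      W * (gaussianReal θ D.toNNReal).real (Icc (-R) R) + ε := by
    intro θ
    have hi : Integrable ((Icc (-R) R).indicator (1 : ℝ → ℝ)) (gaussianReal θ D.toNNReal) :=
      (integrable_const (1 : ℝ)).indicator measurableSet_Icc
    refine (abs_integral_le_integral ((hi.const_mul W).add (integrable_const ε)) (hpt θ)).trans ?_
    simp only [Pi.add_apply]
    rw [integral_add (hi.const_mul W) (integrable_const ε), integral_const_mul,
      integral_indicator_one measurableSet_Icc]
    simp
  have hmi := integrable_gaussianReal_real_Icc δ D R
  rw [condMean]
  refine (abs_integral_le_integral ((hmi.const_mul W).add (integrable_const ε)) hinner).trans ?_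
  simp only [Pi.add_apply]
  rw [integral_add (hmi.const_mul W) (integrable_const ε), integral_const_mul]
  simp [contamMass]

/-- Mean of the contrast between `ψ` and the true parameter. -/
lemma exists_integral_contrast_le {𝒳 : Set (Cov p)} (h𝒳 : Bornology.IsBounded 𝒳)
    (hDL : 0 < DL) (hs2 : 0 < s2) (hW0 : 0 < W)
    (hW : ∀ s ∈ Icc DL s2, ∀ γ ∈ Icc (0 : ℝ) 1, ∀ u, weight γ s u ≤ W) (Lβ : ℝ)
    {γlo γhi : ℝ} (hlo : 0 < γlo) (hhi : γhi < 1)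
    {βs : Cov p} {As : ℝ} (hAs : 0 < As) (hAs2 : As + DU ≤ s2) (hβs : ‖βs‖ ≤ Lβ)
    {ν : Measure (Cov p × ℝ)} [IsProbabilityMeasure ν]
    (hν : ∀ᵐ z ∂ν, z.1 ∈ 𝒳 ∧ z.2 ∈ Icc DL DU) {ε : ℝ} (hε : 0 < ε) :
    ∃ c > 0, ∀ γ ∈ Icc γlo γhi, ∀ ω ∈ Ico (0 : ℝ) (1 / 2), ∀ δ : Measure ℝ,
      IsProbabilityMeasure δ → ∀ ψ : Param p, 0 < ψ.2 → ψ.2 + DU ≤ s2 → ‖ψ.1‖ ≤ Lβ →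
      Integrable (popGap βs As γ ψ) ν →
      ∫ t, contrast DL DU γ ψ (βs, As) t ∂(areaLaw ν βs As ω δ) ≤
        -(∫ z, popGap βs As γ ψ z ∂ν) / 2 + (ω * rho 𝒳 DL DU βs As γ δ / c + ε) := by
  obtain ⟨R, hR⟩ := exists_condMean_contrast_contam_le (DU := DU) h𝒳 hDL hs2 hW0 hW Lβ
    (γlo := γlo) hlo hhi hε
  obtain ⟨c, hc0, hc⟩ := exists_contamMass_le_rho h𝒳 DU hDL βs hAs R
  refine ⟨c / W, by positivity, fun γ hγ ω hω δ _ ψ hψ hψs hψL hi => ?_⟩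
  have hγ1 : γ ∈ Icc (0 : ℝ) 1 := ⟨hlo.le.trans hγ.1, hγ.2.trans hhi.le⟩
  have hω1 : ω ∈ Icc (0 : ℝ) 1 := ⟨hω.1, by linarith [hω.2]⟩
  have hbd := abs_contrast_le (ψ := ψ) (ψ' := (βs, As)) hDL hW0 hW hγ1 hψ hAs hψs hAs2
  obtain ⟨h1, h2⟩ := integral_areaLaw ν βs As hω1 δ (measurable_contrast DL DU γ ψ (βs, As)) hbd
  rw [h2]
  set e := ω * rho 𝒳 DL DU βs As γ δ / (c / W) + ε with he
  have hi2 : Integrable (fun z => -(popGap βs As γ ψ z) / 2 + e) ν :=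
    (hi.neg.div_const 2).add (integrable_const e)
  refine (integral_mono_ae h1 hi2 ?_).trans (le_of_eq ?_)
  · filter_upwards [hν] with z hz
    rw [condMean_contrast_clean hDL (hlo.trans_le hγ.1) hψ hAs hbd hz.2]
    have h3 := popGap_nonneg (βs := βs) hDL hAs (hlo.trans_le hγ.1) hψ hz.2
    have h4 := hR γ hγ δ ‹_› ψ (βs, As) hψ hAs hψs hAs2 hψL hβs z hz.1 hz.2
    have h5 := hc γ hγ1 δ ‹_› z.1 hz.1 z.2 hz.2
    have h6 : W * contamMass δ z.2 R ≤ rho 𝒳 DL DU βs As γ δ / (c / W) := by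
      rw [le_div_iff₀ (by positivity)]
      calc W * contamMass δ z.2 R * (c / W) = c * contamMass δ z.2 R := by field_simp
        _ ≤ _ := h5
    have h7 : ω * condMean (contrast DL DU γ ψ (βs, As)) δ z ≤ e := by
      calc _ ≤ ω * (rho 𝒳 DL DU βs As γ δ / (c / W) + ε) :=
            mul_le_mul_of_nonneg_left ((le_abs_self _).trans (by linarith)) hω.1
        _ = ω * rho 𝒳 DL DU βs As γ δ / (c / W) + ω * ε := by ring
        _ ≤ e := by nlinarith [hω1.2]
    -- As `ω < 1/2` and the gap is nonnegative, the clean share `1 - ω` retains at least half of the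
    -- gap.
    nlinarith [hω.2]
  · have hi3 : Integrable (fun z => -(popGap βs As γ ψ z) / 2) ν := hi.neg.div_const 2
    rw [integral_add hi3 (integrable_const e), integral_div, integral_neg]
    simp

end Contrast

/-! ### Hoeffding's inequality -/

section Concentration

/-- With mean at most `-2 r` per term, a sum above `-(m r)` deviates from its mean by at least `m
r`; a variable in `[-B, B]` is sub-Gaussian with parameter `B²`. -/
lemma measureReal_sum_ge_le_exp {Ω E : Type*} [MeasurableSpace Ω] [MeasurableSpace E]
    {P : Measure Ω} [IsProbabilityMeasure P] {Q : Measure E} {m : ℕ} {X : Fin m → Ω → E}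
    (hind : iIndepFun X P) (hlaw : ∀ i, HasLaw (X i) Q P) {f : E → ℝ} (hf : Measurable f)
    {B r : ℝ} (hB : ∀ t, |f t| ≤ B) (hr : 0 ≤ r) (hmean : ∫ t, f t ∂Q ≤ -(2 * r)) :
    P.real {w | -(m * r) ≤ ∑ i, f (X i w)} ≤ Real.exp (-(m * (r ^ 2 / (2 * B ^ 2)))) := by
  have hE : ∀ i, ∫ w, f (X i w) ∂P = ∫ t, f t ∂Q := fun i => by
    rw [← (hlaw i).map_eq, integral_map (hlaw i).aemeasurable hf.aestronglyMeasurable]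
  have hsub : ∀ i ∈ (Finset.univ : Finset (Fin m)), HasSubgaussianMGF
      (fun w => f (X i w) - ∫ t, f t ∂Q) ((‖B - -B‖₊ / 2) ^ 2) P := fun i _ => by
    rw [← hE i]
    exact hasSubgaussianMGF_of_mem_Icc (hf.comp_aemeasurable (hlaw i).aemeasurable)
      (Eventually.of_forall fun w => abs_le.1 (hB _))
  have hind' : iIndepFun (fun i w => f (X i w) - ∫ t, f t ∂Q) P :=
    hind.comp (fun _ t => f t - ∫ t, f t ∂Q) fun _ => hf.sub_const _
  have h := HasSubgaussianMGF.measure_sum_ge_le_of_iIndepFun hind' hsub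
    (ε := m * r) (by positivity)
  refine (measureReal_mono fun w hw => ?_).trans (h.trans (le_of_eq ?_))
  · simp only [mem_ofPred_eq, Finset.sum_sub_distrib, Finset.sum_const, Finset.card_univ,
      Fintype.card_fin, nsmul_eq_mul] at hw ⊢
    have : (m : ℝ) * ∫ t, f t ∂Q ≤ m * -(2 * r) := by gcongr
    linarith
  · congr 1
    simp only [Finset.sum_const, Finset.card_univ, Fintype.card_fin, nsmul_eq_mul]
    push_cast
    rw [show ‖B - -B‖ / 2 = |B| by
      rw [sub_neg_eq_add, ← two_mul, norm_mul, Real.norm_eq_abs, Real.norm_eq_abs]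
      norm_num, sq_abs]
    -- For `m = 0` or `B = 0`, division by zero makes both exponents vanish.
    rcases eq_or_ne (m : ℝ) 0 with h0 | h0
    · simp [h0]
    rcases eq_or_ne B 0 with hB0 | hB0
    · simp [hB0]
    field_simp

end Concentration

/-! ### Equicontinuity in the parameter -/

section Equicontinuity

/-- The radius is uniform in `y` because everything decays in the residual. So one net point can
replace the random estimate in all areas simultaneously. -/
lemma exists_equicontinuity_radius {𝒳 : Set (Cov p)} (h𝒳 : Bornology.IsBounded 𝒳) {DL DU s2 : ℝ}
    (hDL : 0 < DL) (hs2 : 0 < s2) {γlo γhi : ℝ} (hlo : 0 < γlo) {ε : ℝ} (hε : 0 < ε) :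
    ∃ r > 0, ∀ γ ∈ Icc γlo γhi, ∀ ψ ψ' : Param p, 0 < ψ.2 → 0 < ψ'.2 → ψ.2 + DU ≤ s2 →
      ψ'.2 + DU ≤ s2 → dist ψ ψ' < r → ∀ x ∈ 𝒳, ∀ D ∈ Icc DL DU, ∀ y,
      |wGamma γ ψ x D y - wGamma γ ψ' x D y| ≤ ε ∧
      |thetaTilde γ ψ x D y - thetaTilde γ ψ' x D y| ≤ ε ∧
      |sTildeSq γ ψ x D y - sTildeSq γ ψ' x D y| ≤ ε := by
  obtain ⟨L, hL⟩ := h𝒳.exists_norm_le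
  obtain ⟨r0, hr0, H0⟩ := (unif_weight (γhi := γhi) hDL hs2 hlo).1 ε hε
  obtain ⟨r1, hr1, H1⟩ := (unif_shift (DU := DU) (γhi := γhi) hDL hs2 hlo).1 ε hε
  obtain ⟨r2, hr2, H2⟩ := (unif_varShift (DU := DU) (γhi := γhi) hDL hs2 hlo).1 ε hε
  set r := min r0 (min r1 r2) with hr
  have hrpos : 0 < r := by positivity
  -- The variance moves by at most `dist ψ ψ'` and the residual by at most `|L| * dist ψ ψ'`.
  refine ⟨r / (|L| + 1), by positivity, fun γ hγ ψ ψ' hψ hψ' hψs hψs' hd x hx D hD y => ?_⟩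
  have hγ0 : 0 ≤ γ := hlo.le.trans hγ.1
  have hD0 := hDL.trans_le hD.1
  have h1 : 0 < ψ.2 + D := by positivity
  have h2 : 0 < ψ'.2 + D := by positivity
  rw [lt_div_iff₀ (by positivity)] at hd
  have hβ : ‖ψ.1 - ψ'.1‖ ≤ dist ψ ψ' := by
    rw [← dist_eq_norm]
    exact le_max_left _ _
  have hA : |ψ.2 - ψ'.2| ≤ dist ψ ψ' := by
    rw [← Real.dist_eq]
    exact le_max_right _ _
  have hd0 : 0 ≤ dist ψ ψ' := dist_nonneg
  have hs : |ψ.2 + D - (ψ'.2 + D)| < r := by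
    rw [add_sub_add_right_eq_sub]
    nlinarith [abs_nonneg L]
  have hu : |y - lin x ψ.1 - (y - lin x ψ'.1)| < r := by
    rw [show y - lin x ψ.1 - (y - lin x ψ'.1) = -(lin x ψ.1 - lin x ψ'.1) by ring, abs_neg]
    have h3 : ‖x‖ ≤ |L| := (hL x hx).trans (le_abs_self L)
    have h4 : |lin x ψ.1 - lin x ψ'.1| ≤ |L| * dist ψ ψ' :=
      (abs_lin_sub_le x ψ.1 ψ'.1).trans (by gcongr)
    rcases hd0.eq_or_lt with h0 | h0
    · rw [← h0, mul_zero] at h4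
      linarith
    · nlinarith
  have m1 : ψ.2 + D ∈ Icc DL s2 := ⟨by linarith [hD.1], by linarith [hD.2]⟩
  have m2 : ψ'.2 + D ∈ Icc DL s2 := ⟨by linarith [hD.1], by linarith [hD.2]⟩
  have e0 : r ≤ r0 := min_le_left _ _
  have e1 : r ≤ r1 := (min_le_right _ _).trans (min_le_left _ _)
  have e2 : r ≤ r2 := (min_le_right _ _).trans (min_le_right _ _)
  refine ⟨?_, ?_, ?_⟩
  · rw [wGamma_eq hγ0 h1, wGamma_eq hγ0 h2]
    exact (H0 _ _ _ m1 _ m2 γ hγ (hu.trans_le e0) (hs.trans_le e0)).le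
  · rw [thetaTilde_eq hγ0 h1, thetaTilde_eq hγ0 h2, sub_sub_sub_cancel_left, abs_sub_comm]
    exact (H1 _ _ _ m1 _ m2 γ hγ D hD (hu.trans_le e1) (hs.trans_le e1)).le
  · rw [sTildeSq_eq hγ0 h1, sTildeSq_eq hγ0 h2, add_sub_add_left_eq_sub]
    exact (H2 _ _ _ m1 _ m2 γ hγ D hD (hu.trans_le e2) (hs.trans_le e2)).le

lemma exists_compact_bounds {Ψ : Set (Param p)} (hΨ : IsCompact Ψ) (DU : ℝ) :
    ∃ s2 > 0, ∃ Lβ, ∀ ψ ∈ Ψ, ψ.2 + DU ≤ s2 ∧ ‖ψ.1‖ ≤ Lβ := by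
  obtain ⟨B, hB⟩ := hΨ.isBounded.exists_norm_le
  refine ⟨|B| + |DU| + 1, by positivity, B, fun ψ hψ => ⟨?_, (norm_fst_le ψ).trans (hB ψ hψ)⟩⟩
  have h1 := (le_abs_self ψ.2).trans ((norm_snd_le ψ).trans (hB ψ hψ))
  linarith [le_abs_self B, le_abs_self DU]

end Equicontinuity

/-! ### Consistency of the estimator -/

section Consistency

/-- A finite-net argmax argument with a gap `g` off the `η`-ball. The mean contrast at a far point
is at most `-g/2 + g/8 + g/8 = -2 (g/8)`, so off a Hoeffding event its sum is below `-(m g/8)`. A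
far maximizer has nonnegative total contrast, and moving it to the net costs at most `g/8` per area,
which forces that event. `N` and `c` are uniform in `γ`, `ω`, `δ` and `S`. -/
lemma exists_estimate_far_le {𝒳 : Set (Cov p)} (h𝒳 : Bornology.IsBounded 𝒳) {DL DU : ℝ}
    (hDL : 0 < DL) {βs : Cov p} {As : ℝ} {ν : Measure (Cov p × ℝ)}
    [IsProbabilityMeasure ν] (hν : ∀ᵐ z ∂ν, z.1 ∈ 𝒳 ∧ z.2 ∈ Icc DL DU)
    (hM : (secondMoment ν).PosDef) {Ψ : Set (Param p)} (hΨ : IsCompact Ψ)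
    (hpos : ∀ ψ ∈ Ψ, 0 < ψ.2) (hmem : (βs, As) ∈ Ψ) {γlo γhi : ℝ} (hlo : 0 < γlo) (hhi : γhi < 1)
    {η τ : ℝ} (hη : 0 < η) (hτ : 0 < τ) :
    ∃ N : ℕ, ∃ c > 0, ∀ m ≥ N, ∀ γ ∈ Icc γlo γhi, ∀ ω ∈ Ico (0 : ℝ) (1 / 2), ∀ δ : Measure ℝ,
      IsProbabilityMeasure δ → ω * rho 𝒳 DL DU βs As γ δ ≤ c →
      ∀ S : Set (Param p), (βs, As) ∈ S → S ⊆ Ψ →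
      ∀ (Ω : Type*) (_ : MeasurableSpace Ω) (P : Measure Ω), IsProbabilityMeasure P →
      ∀ (x : Fin m → Ω → Cov p) (D θ y : Fin m → Ω → ℝ),
      iIndepFun (fun i w => (((x i w, D i w), θ i w), y i w)) P →
      (∀ i, HasLaw (fun w => (((x i w, D i w), θ i w), y i w)) (areaLaw ν βs As ω δ) P) →
      ∀ ψhat : Ω → Param p,
      (∀ᵐ w ∂P, IsGammaEstimate γ S (fun i => x i w) (fun i => D i w) (fun i => y i w) (ψhat w)) →
      P.real {w | η ≤ dist (ψhat w) (βs, As)} ≤ τ := by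
  obtain ⟨s2, hs2, Lβ, hsL⟩ := exists_compact_bounds hΨ DU
  have hAs : 0 < As := hpos _ hmem
  obtain ⟨W, hW0, hW'⟩ := abs_weight_sub_one_le (s1 := DL) (s2 := s2) hDL
  have hW : ∀ s ∈ Icc DL s2, ∀ γ ∈ Icc (0 : ℝ) 1, ∀ u, weight γ s u ≤ W :=
    fun s hs γ hγ u => (hW' s hs γ hγ u).2
  set K := Ψ \ Metric.ball (βs, As) η with hKdef
  have hK : IsCompact K := hΨ.diff Metric.isOpen_ball
  obtain ⟨g, hg0, hg⟩ := exists_popGap_lower_bound (βs := βs) hDL hAs h𝒳 hν hM hK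
    (fun ψ hψ => hpos ψ hψ.1) (fun h => h.2 (Metric.mem_ball_self hη)) hlo hhi
  obtain ⟨r, hr0, hr⟩ := exists_equicontinuity_radius (p := p) h𝒳 (DU := DU) hDL hs2 (γhi := γhi)
    hlo (ε := g / 8) (by positivity)
  obtain ⟨c, hc0, hc⟩ := exists_integral_contrast_le (p := p) h𝒳 hDL hs2 hW0 hW Lβ hlo hhi hAs
    (hsL _ hmem).1 (hsL _ hmem).2 hν (ε := g / 8) (by positivity)
  -- The net does not depend on `m`, so the union bound has a fixed number of exponentially small
  -- terms.
  obtain ⟨T, hTK, hTfin, hTcov⟩ := Metric.finite_approx_of_totallyBounded hK.totallyBounded r hr0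
  have hlim : Tendsto (fun m : ℕ => (hTfin.toFinset.card : ℝ) *
      Real.exp (-(m * ((g / 8) ^ 2 / (2 * W ^ 2))))) atTop (𝓝 0) := by
    have h1 : Tendsto (fun m : ℕ => (m : ℝ) * ((g / 8) ^ 2 / (2 * W ^ 2))) atTop atTop :=
      tendsto_natCast_atTop_atTop.atTop_mul_const (by positivity)
    simpa using (Real.tendsto_exp_neg_atTop_nhds_zero.comp h1).const_mul
      (hTfin.toFinset.card : ℝ)
  obtain ⟨N, hN⟩ := eventually_atTop.1 (hlim.eventually (eventually_le_nhds hτ))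
  refine ⟨N, c * (g / 8), by positivity, ?_⟩
  intro m hm γ hγ ω hω δ _ hρ S hS hSΨ Ω _ P _ x D θ y hind hlaw ψhat hψhat
  have hγ1 : γ ∈ Icc (0 : ℝ) 1 := ⟨hlo.le.trans hγ.1, hγ.2.trans hhi.le⟩
  have hγ0 : 0 < γ := hlo.trans_le hγ.1
  have hω1 : ω ∈ Icc (0 : ℝ) 1 := ⟨hω.1, by linarith [hω.2]⟩
  set X : Fin m → Ω → ((Cov p × ℝ) × ℝ) × ℝ :=
    fun i w => (((x i w, D i w), θ i w), y i w) with hX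
  let bad : Param p → Set Ω := fun ψ =>
    {w | -(m * (g / 8)) ≤ ∑ i, contrast DL DU γ ψ (βs, As) (X i w)}
  have hbad : ∀ ψ ∈ K, P.real (bad ψ) ≤ Real.exp (-(m * ((g / 8) ^ 2 / (2 * W ^ 2)))) := by
    intro ψ hψ
    refine measureReal_sum_ge_le_exp hind hlaw (measurable_contrast _ _ _ _ _)
      (abs_contrast_le hDL hW0 hW hγ1 (hpos ψ hψ.1) hAs (hsL ψ hψ.1).1 (hsL _ hmem).1)
      (by positivity) ?_
    obtain ⟨g1, g2⟩ := hg γ hγ ψ hψ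
    refine (hc γ hγ ω hω δ ‹_› ψ (hpos ψ hψ.1) (hsL ψ hψ.1).1 (hsL ψ hψ.1).2 g1).trans ?_
    have : ω * rho 𝒳 DL DU βs As γ δ / c ≤ g / 8 := by
      rw [div_le_iff₀ hc0]
      linarith
    linarith
  have hgood : ∀ᵐ w ∂P, ∀ i, x i w ∈ 𝒳 ∧ D i w ∈ Icc DL DU := by
    refine ae_all_iff.2 fun i => ?_
    have h := ae_areaLaw βs As hω1 δ hν
    rw [← (hlaw i).map_eq] at h
    exact ae_of_ae_map (hlaw i).aemeasurable h
  have hcover : {w | η ≤ dist (ψhat w) (βs, As)} ≤ᵐ[P] ⋃ ψ ∈ hTfin.toFinset, bad ψ := by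
    filter_upwards [hgood, hψhat] with w hw hest hfar
    obtain ⟨hmemS, hmax⟩ := hest
    have hψK : ψhat w ∈ K := ⟨hSΨ hmemS, fun hb => not_lt.2 hfar (Metric.mem_ball.1 hb)⟩
    obtain ⟨ψ, hψT, hψd⟩ := mem_iUnion₂.1 (hTcov hψK)
    refine mem_iUnion₂.2 ⟨ψ, hTfin.mem_toFinset.2 hψT, ?_⟩
    have hψK' := hTK hψT
    have h1 := hmax (βs, As) hS
    simp only [gammaLik, ← Finset.mul_sum] at h1
    have h2 := le_of_mul_le_mul_left h1 (by positivity)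
    have h3 : ∀ i, wGamma γ (ψhat w) (x i w) (D i w) (y i w) -
        wGamma γ (βs, As) (x i w) (D i w) (y i w) - g / 8 ≤
        contrast DL DU γ ψ (βs, As) (X i w) := by
      intro i
      rw [hX, contrast_eq (hw i).2]
      have h4 := (hr γ hγ (ψhat w) ψ (hpos _ hψK.1) (hpos _ hψK'.1) (hsL _ hψK.1).1
        (hsL _ hψK'.1).1 hψd (x i w) (hw i).1 (D i w) (hw i).2 (y i w)).1
      linarith [(abs_le.1 h4).2]
    have h5 := Finset.sum_le_sum fun i (_ : i ∈ Finset.univ) => h3 i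
    simp only [Finset.sum_sub_distrib, Finset.sum_const, Finset.card_univ, Fintype.card_fin,
      nsmul_eq_mul] at h5
    change -(m * (g / 8)) ≤ ∑ i, contrast DL DU γ ψ (βs, As) (X i w)
    linarith
  calc P.real {w | η ≤ dist (ψhat w) (βs, As)}
      ≤ P.real (⋃ ψ ∈ hTfin.toFinset, bad ψ) :=
        ENNReal.toReal_mono (measure_ne_top _ _) (measure_mono_ae hcover)
    _ ≤ ∑ ψ ∈ hTfin.toFinset, P.real (bad ψ) := measureReal_biUnion_finset_le _ _
    _ ≤ ∑ ψ ∈ hTfin.toFinset, Real.exp (-(m * ((g / 8) ^ 2 / (2 * W ^ 2)))) :=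
        Finset.sum_le_sum fun ψ hψ => hbad ψ (hTK (hTfin.mem_toFinset.1 hψ))
    _ = hTfin.toFinset.card * Real.exp (-(m * ((g / 8) ^ 2 / (2 * W ^ 2)))) := by
        rw [Finset.sum_const, nsmul_eq_mul]
    _ ≤ τ := hN m hm

end Consistency

/-! ### From the estimated parameter to the true one -/

section Sandwich

lemma mem_robustInterval_iff {α γ : ℝ} {ψ : Param p} {x : Cov p} {D y θ : ℝ} :
    θ ∈ robustInterval α γ ψ x D y ↔
      |θ - thetaTilde γ ψ x D y| < zUpper (α / 2) * √(sTildeSq γ ψ x D y) := by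
  rw [robustInterval, mem_Ioo, abs_lt]
  constructor <;> rintro ⟨h1, h2⟩ <;> constructor <;> linarith

/-- Near the true parameter, the interval is squeezed between two perturbed intervals. -/
lemma exists_interval_sandwich {𝒳 : Set (Cov p)} (h𝒳 : Bornology.IsBounded 𝒳) {DL DU : ℝ}
    (hDL : 0 < DL) {Ψ : Set (Param p)} (hΨ : IsCompact Ψ) (hpos : ∀ ψ ∈ Ψ, 0 < ψ.2) (α : ℝ)
    {γlo γhi : ℝ} (hlo : 0 < γlo) {ψs : Param p} (hmem : ψs ∈ Ψ) {ε : ℝ} (hε : 0 < ε) :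
    ∃ η > 0, ∀ γ ∈ Icc γlo γhi, ∀ ψ ∈ Ψ, dist ψ ψs < η → ∀ x ∈ 𝒳, ∀ D ∈ Icc DL DU, ∀ θ y,
      (θ ∈ robustInterval α γ ψ x D y → (((x, D), θ), y) ∈ coverSet p α γ ψs ε) ∧
      ((((x, D), θ), y) ∈ coverSet p α γ ψs (-ε) → θ ∈ robustInterval α γ ψ x D y) := by
  obtain ⟨s2, hs2, Lβ, hsL⟩ := exists_compact_bounds hΨ DU
  set ζ := |zUpper (α / 2)| with hζ
  set κ := ε / (2 * (1 + ζ)) with hκ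
  have hκ0 : 0 < κ := by positivity
  have hsum : κ + ζ * κ ≤ ε := by
    have h : 2 * (1 + ζ) ≠ 0 := by positivity
    have : κ * (2 * (1 + ζ)) = ε := div_mul_cancel₀ _ h
    linarith
  -- The tolerance `κ` is for the centre, and `κ²` for `s̃²`, so that the Hölder bound gives `κ` for
  -- `s̃`.
  obtain ⟨η, hη0, hη⟩ := exists_equicontinuity_radius (p := p) h𝒳 (DU := DU) hDL hs2 (γhi := γhi)
    hlo (ε := min κ (κ ^ 2)) (by positivity)
  refine ⟨η, hη0, fun γ hγ ψ hψ hd x hx D hD θ y => ?_⟩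
  obtain ⟨-, h1, h2⟩ := hη γ hγ ψ ψs (hpos ψ hψ) (hpos _ hmem) (hsL ψ hψ).1 (hsL _ hmem).1 hd
    x hx D hD y
  have h3 := h1.trans (min_le_left _ _)
  have h4 : |√(sTildeSq γ ψ x D y) - √(sTildeSq γ ψs x D y)| ≤ κ := by
    refine (abs_sqrt_sub_sqrt_le_sqrt _ _).trans ?_
    rw [Real.sqrt_le_left hκ0.le]
    exact h2.trans (min_le_right _ _)
  have h5 : |zUpper (α / 2) * √(sTildeSq γ ψ x D y) - zUpper (α / 2) * √(sTildeSq γ ψs x D y)| ≤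
      ζ * κ := by
    rw [← mul_sub, abs_mul]
    gcongr
  have h6 : |(|θ - thetaTilde γ ψ x D y| - |θ - thetaTilde γ ψs x D y|)| ≤ κ := by
    refine (abs_abs_sub_abs_le_abs_sub _ _).trans ?_
    rw [sub_sub_sub_cancel_left, abs_sub_comm]
    exact h3
  have h5' := abs_le.1 h5
  have h6' := abs_le.1 h6
  rw [mem_robustInterval_iff]
  constructor
  · intro h
    change |θ - thetaTilde γ ψs x D y| < zUpper (α / 2) * √(sTildeSq γ ψs x D y) + ε
    linarith
  · intro h
    change |θ - thetaTilde γ ψs x D y| < zUpper (α / 2) * √(sTildeSq γ ψs x D y) + -ε at h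
    linarith

end Sandwich

end RobustFH

end

/-! ### Assembly of the coverage bound -/

theorem theorem4 {p : ℕ} (DL DU : ℝ) (hDL : 0 < DL) (hDLU : DL ≤ DU)
    -- true parameter and nominal level
    (βs : RobustFH.Cov p) (As : ℝ) (hAs : 0 < As)
    (hAD : (2 * Real.pi)⁻¹ * Real.exp (-3) < As + DL)
    (α : ℝ) (hα : α ∈ Ioo (0 : ℝ) 1) :
    -- the constant does not depend on the tuning parameter, nor on `γlo`, `γhi`
    ∃ C : ℝ, 0 < C ∧
      ∀ (𝒳 : Set (RobustFH.Cov p)), Bornology.IsBounded 𝒳 →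
      -- law of `(x, D)`
      ∀ (ν : Measure (RobustFH.Cov p × ℝ)), IsProbabilityMeasure ν →
      (∀ᵐ z ∂ν, z.1 ∈ 𝒳 ∧ z.2 ∈ Icc DL DU) →
      (RobustFH.secondMoment ν).PosDef →
      -- compact parameter space, and the sets over which the objective is maximized
      ∀ (Ψ : Set (RobustFH.Param p)), IsCompact Ψ → (∀ ψ ∈ Ψ, 0 < ψ.2) →
      ∀ (S : ℕ → Set (RobustFH.Param p)), (∀ m, (βs, As) ∈ S m ∧ S m ⊆ Ψ) →
      -- tuning parameter
      ∀ (γlo γhi : ℝ), 0 < γlo → γlo < γhi → γhi < 1 →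
      ∀ (γ : ℕ → ℝ), (∀ m, γ m ∈ Icc γlo γhi) →
      -- contamination ratio and contamination distribution
      ∀ (ω : ℕ → ℝ), (∀ m, ω m ∈ Ico (0 : ℝ) (1 / 2)) →
      ∀ (δ : ℕ → Measure ℝ), (∀ m, IsProbabilityMeasure (δ m)) →
      (∀ m, ∀ D ∈ Icc DL DU, Integrable (fun y => y ^ 2 * RobustFH.margDens (δ m) D y)) →
      ∀ (ζ : ℝ), ζ ∈ Ioo (0 : ℝ) (1 / 2) →
      ((fun m : ℕ => ω m * RobustFH.rho 𝒳 DL DU βs As (γ m) (δ m)) =O[atTop]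
        fun m : ℕ => (m : ℝ) ^ (-ζ)) →
      -- samples: for each `m`, the `m` areas are i.i.d. from the contaminated model
      ∀ (Ω : ℕ → Type*) (_ : ∀ m, MeasurableSpace (Ω m))
        (P : ∀ m, Measure (Ω m)), (∀ m, IsProbabilityMeasure (P m)) →
      ∀ (x : ∀ m, Fin m → Ω m → RobustFH.Cov p) (D θ y : ∀ m, Fin m → Ω m → ℝ),
      (∀ m, iIndepFun (fun i w => (((x m i w, D m i w), θ m i w), y m i w)) (P m)) →
      (∀ m i, HasLaw (fun w => (((x m i w, D m i w), θ m i w), y m i w))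
        (RobustFH.areaLaw ν βs As (ω m) (δ m)) (P m)) →
      -- the robust estimator
      ∀ (ψhat : ∀ m, Ω m → RobustFH.Param p), (∀ m, AEMeasurable (ψhat m) (P m)) →
      (∀ m, ∀ᵐ w ∂(P m), RobustFH.IsGammaEstimate (γ m) (S m)
        (fun i => x m i w) (fun i => D m i w) (fun i => y m i w) (ψhat m w)) →
      ∀ᶠ m in atTop, ∀ i : Fin m,
        |(P m).real {w | θ m i w ∈
            RobustFH.robustInterval α (γ m) (ψhat m w) (x m i w) (D m i w) (y m i w)} - (1 - α)|
          ≤ C * ((ω m * RobustFH.rho 𝒳 DL DU βs As (γ m) (δ m)) ^ (1 / 4 : ℝ) + γ m) := by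
  obtain ⟨K, hK0, hK⟩ := RobustFH.exists_coverage_bound hDL hDLU βs hAs hα
  refine ⟨2 * K + 2, by positivity, ?_⟩
  intro 𝒳 h𝒳 ν _ hν hM Ψ hΨ hΨpos S hS γlo γhi hlo _ hhi γ hγ ω hω δ hδ _ ζ hζ hO
    Ω _ P hP x D θ y hind hlaw ψhat _ hest
  have hmem : (βs, As) ∈ Ψ := (hS 0).2 (hS 0).1
  -- Every tolerance is set to `γlo`: the half-width perturbation here and in the sandwich, and the
  -- probability that the estimate is far.
  obtain ⟨c, hc0, hc⟩ := hK 𝒳 h𝒳 ν ‹_› hν γlo γhi hlo hhi γlo hlo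
  obtain ⟨η, hη0, hη⟩ := RobustFH.exists_interval_sandwich h𝒳 (DU := DU) hDL hΨ hΨpos α
    (γhi := γhi) hlo hmem hlo
  obtain ⟨N, c', hc'0, hfar⟩ := RobustFH.exists_estimate_far_le h𝒳 hDL hν hM hΨ hΨpos hmem hlo hhi
    hη0 hlo
  have hlim : Tendsto (fun m : ℕ => ω m * RobustFH.rho 𝒳 DL DU βs As (γ m) (δ m)) atTop (𝓝 0) :=
    hO.trans_tendsto ((tendsto_rpow_neg_atTop hζ.1).comp tendsto_natCast_atTop_atTop)
  filter_upwards [eventually_ge_atTop N, hlim.eventually (eventually_le_nhds hc'0),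
    hlim.eventually (eventually_le_nhds (show 0 < c * γlo by positivity))] with m hmN hm1 hm2 i
  have hδm := hδ m
  have hPm := hP m
  have hω1 : ω m ∈ Icc (0 : ℝ) 1 := ⟨(hω m).1, by linarith [(hω m).2]⟩
  have hF := hfar m hmN (γ m) (hγ m) (ω m) (hω m) (δ m) hδm hm1 (S m) (hS m).1 (hS m).2 (Ω m) _
    (P m) hPm (x m) (D m) (θ m) (y m) (hind m) (hlaw m) (ψhat m) (hest m)
  have hρ : ω m * RobustFH.rho 𝒳 DL DU βs As (γ m) (δ m) / c ≤ γlo := by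
    rw [div_le_iff₀ hc0]
    linarith
  have hcov : ∀ κ, |κ| ≤ γlo → |(P m).real ((fun w => (((x m i w, D m i w), θ m i w), y m i w)) ⁻¹'
      RobustFH.coverSet p α (γ m) (βs, As) κ) - (1 - α)| ≤ K * (γ m + γlo) + γlo := by
    intro κ hκ
    have h := hc (γ m) (hγ m) (ω m) hω1 (δ m) hδm κ hκ
    rw [← (hlaw m i).map_eq, map_measureReal_apply_of_aemeasurable (hlaw m i).aemeasurable
      (RobustFH.measurableSet_coverSet _ _ _ _)] at h
    exact h.trans (by linarith)
  have hgood : ∀ᵐ w ∂(P m), x m i w ∈ 𝒳 ∧ D m i w ∈ Icc DL DU := by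
    have h := RobustFH.ae_areaLaw βs As hω1 (δ m) hν
    rw [← (hlaw m i).map_eq] at h
    exact ae_of_ae_map (hlaw m i).aemeasurable h
  set T := {w | θ m i w ∈
    RobustFH.robustInterval α (γ m) (ψhat m w) (x m i w) (D m i w) (y m i w)} with hT
  set far := {w | η ≤ dist (ψhat m w) (βs, As)} with hfardef
  have hupper : T ≤ᵐ[P m] ((fun w => (((x m i w, D m i w), θ m i w), y m i w)) ⁻¹'
      RobustFH.coverSet p α (γ m) (βs, As) γlo ∪ far : Set (Ω m)) := by
    filter_upwards [hgood, hest m] with w hw he hwT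
    by_cases hd : η ≤ dist (ψhat m w) (βs, As)
    · exact Or.inr hd
    · exact Or.inl ((hη (γ m) (hγ m) _ ((hS m).2 he.1) (not_le.1 hd) _ hw.1 _ hw.2 _ _).1 hwT)
  have hlower : ((fun w => (((x m i w, D m i w), θ m i w), y m i w)) ⁻¹'
      RobustFH.coverSet p α (γ m) (βs, As) (-γlo) : Set (Ω m)) ≤ᵐ[P m] (T ∪ far : Set (Ω m)) := by
    filter_upwards [hgood, hest m] with w hw he hwT
    by_cases hd : η ≤ dist (ψhat m w) (βs, As)
    · exact Or.inr hd
    · exact Or.inl ((hη (γ m) (hγ m) _ ((hS m).2 he.1) (not_le.1 hd) _ hw.1 _ hw.2 _ _).2 hwT)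
  have hU := (ENNReal.toReal_mono (measure_ne_top _ _) (measure_mono_ae hupper)).trans
    (measureReal_union_le _ _)
  have hL := (ENNReal.toReal_mono (measure_ne_top _ _) (measure_mono_ae hlower)).trans
    (measureReal_union_le _ _)
  rw [← measureReal_def] at hU hL
  have hc1 := abs_le.1 (hcov γlo (abs_of_pos hlo).le)
  have hc2 := abs_le.1 (hcov (-γlo) (by rw [abs_neg, abs_of_pos hlo]))
  have hγm := (hγ m).1
  have hKγ : K * (γ m + γlo) ≤ K * (2 * γ m) := by
    gcongr
    linarith
  -- The budget is `K (γ m + γlo)` for the perturbed interval, `γlo` for contamination and `γlo` for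
  -- the far event, and `γlo ≤ γ m`.
  have hmain : |(P m).real T - (1 - α)| ≤ (2 * K + 2) * γ m := by
    rw [abs_le]
    constructor <;> linarith [hc1.1, hc1.2, hc2.1, hc2.2]
  refine hmain.trans ?_
  have hρ0 : 0 ≤ (ω m * RobustFH.rho 𝒳 DL DU βs As (γ m) (δ m)) ^ (1 / 4 : ℝ) :=
    Real.rpow_nonneg (mul_nonneg (hω m).1 (RobustFH.rho_nonneg _ _ _ _ _ _ _)) _
  gcongr
  linarith
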